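/- Let $d\in\mathbb N$ and let $h:\mathbb R^d\to\mathbb R$ be of class $C^2$ (in particular, any smooth $h$ is allowed), coercive, i.e. $h(\xi)\to+\infty$ as $|\xi|\to\infty$, and with superlinear growth, i.e. $h(\xi)/|\xi|\to+\infty$ as $|\xi|\to\infty$. Suppose that there are $\xi_0\in\mathbb R^d$ and an integer $1\le m\le d-1$ such that, counted with multiplicity, $D^2h(\xi_0)$ has $m$ strictly positive and $d-m$ strictly negative eigenvalues ($Dh(\xi_0)$ need not vanish). Then there exist a probability space $(\Omega,\mathcal F,\mathbb P)$, a jointly measurable, measure-preserving and ergodic action $(\sigma_{(x,t)})_{(x,t)\in\mathbb R^d\times\mathbb R}$ of the additive group $\mathbb R^d\times\mathbb R$ on it, and a random field $V:\mathbb R^d\times\mathbb R\times\Omega\to\mathbb R$, measurable in $\omega$, which is space-time stationary, $V(x+y,t+s,\omega)=V(x,t,\sigma_{(y,s)}\omega)$, and which is bounded and Lipschitz continuous in $(x,t)$ with constants independent of $\omega$, such that the following holds. For every $\omega\in\Omega$ and every $\varepsilon>0$ the initial value problem $$u^\varepsilon_t+h(Du^\varepsilon)-V\!\left(\tfrac{x}{\varepsilon},\tfrac{t}{\varepsilon},\omega\right)=0\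 \text{ in }\ \mathbb R^d\times(0,\infty),\qquad u^\varepsilon(x,0)=\xi_0\cdot x,$$ has exactly one viscosity solution $u^\varepsilon=u^\varepsilon(\cdot,\cdot,\omega)$ among the continuous functions on $\mathbb R^d\times[0,\infty)$ for which $u^\varepsilon(x,t)-\xi_0\cdot x$ is bounded on $\mathbb R^d\times[0,T]$ for every $T>0$; and this solution does not homogenize, in the sense that, almost surely, for all $t>0$, $$\liminf_{\varepsilon\to0^+}u^\varepsilon(0,t)<\limsup_{\varepsilon\to0^+}u^\varepsilon(0,t).$$ -/

import Mathlib

open Filter Topology MeasureTheory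

/-- The Euclidean space `ℝᵈ`. -/
abbrev Eucl (d : ℕ) : Type := EuclideanSpace ℝ (Fin d)

/-- The Hessian matrix `D²h(ξ)` in the standard basis of `ℝᵈ`. -/
noncomputable def hessianMatrix {d : ℕ} (h : Eucl d → ℝ) (ξ : Eucl d) :
    Matrix (Fin d) (Fin d) ℝ :=
  Matrix.of fun i j =>
    fderiv ℝ (fderiv ℝ h) ξ (EuclideanSpace.single i 1) (EuclideanSpace.single j 1)

/-- The Hessian of a `C²` function is symmetric, so that its real eigenvalues (listed with
multiplicity) make sense. -/
theorem hessianMatrix_isHermitian {d : ℕ} {h : Eucl d → ℝ} (hh : ContDiff ℝ 2 h) (ξ : Eucl d) :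
    (hessianMatrix h ξ).IsHermitian := by
  have hs : IsSymmSndFDerivAt ℝ h ξ :=
    hh.contDiffAt.isSymmSndFDerivAt (by simp)
  ext i j
  simpa [hessianMatrix] using hs (EuclideanSpace.single j 1) (EuclideanSpace.single i 1)

/-- The Hamiltonian `h` is coercive: `h(ξ) → +∞` as `|ξ| → ∞`. -/
def Coercive {d : ℕ} (h : Eucl d → ℝ) : Prop :=
  Tendsto h (cocompact (Eucl d)) atTop

/-- The Hamiltonian `h` has superlinear growth: `h(ξ) / |ξ| → +∞` as `|ξ| → ∞`. -/
def SuperlinearGrowth {d : ℕ} (h : Eucl d → ℝ) : Prop :=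
  Tendsto (fun ξ => h ξ / ‖ξ‖) (cocompact (Eucl d)) atTop

/-- `u` is a viscosity subsolution of `u_t + H(Du, x, t) = 0` in `ℝᵈ × (0, ∞)`. -/
def IsViscositySubsolution {d : ℕ} (H : Eucl d → Eucl d → ℝ → ℝ) (u : Eucl d × ℝ → ℝ) : Prop :=
  ∀ φ : Eucl d × ℝ → ℝ, ContDiff ℝ 1 φ → ∀ (x : Eucl d) (t : ℝ), 0 < t →
    IsLocalMax (fun z => u z - φ z) (x, t) →
      deriv (fun s => φ (x, s)) t + H (gradient (fun y => φ (y, t)) x) x t ≤ 0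

/-- `u` is a viscosity supersolution of `u_t + H(Du, x, t) = 0` in `ℝᵈ × (0, ∞)`. -/
def IsViscositySupersolution {d : ℕ} (H : Eucl d → Eucl d → ℝ → ℝ) (u : Eucl d × ℝ → ℝ) : Prop :=
  ∀ φ : Eucl d × ℝ → ℝ, ContDiff ℝ 1 φ → ∀ (x : Eucl d) (t : ℝ), 0 < t →
    IsLocalMin (fun z => u z - φ z) (x, t) →
      0 ≤ deriv (fun s => φ (x, s)) t + H (gradient (fun y => φ (y, t)) x) x t

/-- `u` is a viscosity solution of the initial value problem `u_t + H(Du, x, t) = 0` in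
`ℝᵈ × (0, ∞)`, `u(x, 0) = ξ₀ · x`: it is continuous on `ℝᵈ × [0, ∞)`, takes the initial datum, is
both a sub- and a supersolution, and stays at bounded distance from the datum on bounded time
intervals (the usual class in which the problem is well posed). The values of `u` at negative times
are irrelevant. -/
structure IsViscositySolution {d : ℕ} (H : Eucl d → Eucl d → ℝ → ℝ) (ξ₀ : Eucl d)
    (u : Eucl d × ℝ → ℝ) : Prop where
  continuousOn : ContinuousOn u {z | 0 ≤ z.2}
  initial : ∀ x, u (x, 0) = inner ℝ ξ₀ x
  bounded : ∀ T : ℝ, ∃ C : ℝ, ∀ (x : Eucl d) (t : ℝ), 0 ≤ t → t ≤ T → |u (x, t) - inner ℝ ξ₀ x| ≤ C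
  sub : IsViscositySubsolution H u
  super : IsViscositySupersolution H u

/-- The rescaled Hamiltonian `h(ξ) - V(x/ε, t/ε)`, for a realization `V` of the potential. -/
noncomputable def scaledHamiltonian {d : ℕ} (h : Eucl d → ℝ) (V : Eucl d → ℝ → ℝ) (ε : ℝ) :
    Eucl d → Eucl d → ℝ → ℝ :=
  fun ξ x t => h ξ - V (ε⁻¹ • x) (t / ε)

/-- `V = V(x, t, ω)` is a space-time stationary ergodic random field, with respect to a jointly
measurable action `σ` of the group `ℝᵈ × ℝ` on the probability space `(Ω, P)`: the action preserves
`P` and is ergodic, and `V(x + y, t + s, ω) = V(x, t, σ_{(y, s)} ω)`. -/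
structure IsStationaryErgodicField {d : ℕ} {Ω : Type} [MeasurableSpace Ω]
    [AddAction (Eucl d × ℝ) Ω] (P : Measure Ω) (V : Eucl d → ℝ → Ω → ℝ) : Prop where
  isProbability : IsProbabilityMeasure P
  measurable_action : MeasurableVAdd₂ (Eucl d × ℝ) Ω
  ergodic : ErgodicVAdd (Eucl d × ℝ) Ω P
  measurable : ∀ x t, Measurable (V x t)
  stationary : ∀ (x y : Eucl d) (t s : ℝ) (ω : Ω),
    V (x + y) (t + s) ω = V x t (((y, s) : Eucl d × ℝ) +ᵥ ω)

/-- The realizations of `V` are bounded and Lipschitz continuous in `(x, t)`, with constants that do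
not depend on the realization. -/
def IsBoundedLipschitzField {d : ℕ} {Ω : Type} (V : Eucl d → ℝ → Ω → ℝ) : Prop :=
  (∃ C : ℝ, ∀ x t ω, |V x t ω| ≤ C) ∧
    ∃ K : NNReal, ∀ ω, LipschitzWith K (fun z : Eucl d × ℝ => V z.1 z.2 ω)

/-!
The Hamiltonian has a saddle at `ξ₀`: along the line through `ξ₀` in the direction of an eigenvector
`e` it lies above a parabola tangent to its linear part, of slope `β`, and along an eigenvector `f`
below one, of slope `γ`. In the game interpretation of the equation, with the drift removed, the
minimizing player moves freely in the direction `e` and the maximizing player in the direction `f`.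
If the potential takes its minimum on a slab `⟨e, x⟩ - β t ≈ const` that passes close to a point,
the minimizing player goes to the slab and stays in it whatever the opponent does, so that
the solution descends at a definite rate faster than `-h ξ₀`, provided that no other structure is
visible. This is `solution_le_of_slab`; its proof is an explicit smooth strict supersolution.
Slabs in the direction `f` on which the potential is maximal have the opposite effect, which
follows by passing to `-u`.

The environment has slabs of all generations `k`, with spacing `period k`, of the first type for
even `k` and of the second for odd `k`, later generations overriding earlier ones (`env`). At the
length scale `zoom k`, which lies between `period k` and `period (k + 1)`, the slabs of generation
`k` are dense, while those of later generations are too far away to be seen. So the two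
effects alternate along the scales `(zoom k)⁻¹ → 0`, and the solutions do not converge.
Slabs of late generations have tiny density, hence the alternation does not contradict ergodicity.

The only randomness is in the phases of the slabs, one point of the circle per generation. The
sample space is the closure of the group of phases that are reached from zero by translations of
space-time, with its Haar probability measure: translations have dense range in this compact group,
hence act ergodically (`ergodicVAdd_phaseMeasure`). Each phase is uniformly
distributed, so that by the Borel-Cantelli lemma the slabs of generation `k + 1` are almost surely,
for all large `k`, much farther from the origin than `zoom k` (`ae_eventually_phase_large`).

Well-posedness is proved without using coercivity of the Hamiltonian: smooth barriers bound the
distance of a solution to its initial datum by a multiple of the time, doubling of variables gives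
the comparison principle for semicontinuous sub- and supersolutions (`comparison`), and
Perron's method gives existence (`exists_isViscositySolution`).
-/

/-! ### The operator on smooth functions, and duality -/

theorem hasGradientAt_normSq_sub {d : ℕ} (a x : Eucl d) :
    HasGradientAt (fun y => ‖y - a‖ ^ 2) ((2 : ℝ) • (x - a)) x := by
  rw [hasGradientAt_iff_hasFDerivAt]
  have h := ((hasFDerivAt_id x).sub_const a).norm_sq
  refine h.congr_fderiv ?_
  ext v
  simp

theorem hasGradientAt_inner {d : ℕ} (a x : Eucl d) :
    HasGradientAt (fun y => inner ℝ a y) a x := by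
  rw [hasGradientAt_iff_hasFDerivAt]
  exact ((InnerProductSpace.toDual ℝ (Eucl d)) a).hasFDerivAt

theorem HasGradientAt.comp_real {d : ℕ} {g : ℝ → ℝ} {g' : ℝ} {f : Eucl d → ℝ} {p x : Eucl d}
    (hg : HasDerivAt g g' (f x)) (hf : HasGradientAt f p x) :
    HasGradientAt (fun y => g (f y)) (g' • p) x := by
  rw [hasGradientAt_iff_hasFDerivAt] at hf ⊢
  refine (hg.comp_hasFDerivAt x hf).congr_fderiv ?_
  simp

theorem HasGradientAt.add' {d : ℕ} {f g : Eucl d → ℝ} {p q x : Eucl d}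
    (hf : HasGradientAt f p x) (hg : HasGradientAt g q x) :
    HasGradientAt (fun y => f y + g y) (p + q) x := by
  rw [hasGradientAt_iff_hasFDerivAt] at *
  exact (hf.add hg).congr_fderiv (map_add _ _ _).symm

theorem hasGradientAt_const' {d : ℕ} (c : ℝ) (x : Eucl d) :
    HasGradientAt (fun _ => c) 0 x := by
  rw [hasGradientAt_iff_hasFDerivAt]
  simpa using hasFDerivAt_const c x

/-- The smooth substitute `√(1 + |x - a|²) - 1` for the distance to `a`. -/
noncomputable def softDist {d : ℕ} (a x : Eucl d) : ℝ := √(1 + ‖x - a‖ ^ 2) - 1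

theorem softDist_nonneg {d : ℕ} (a x : Eucl d) : 0 ≤ softDist a x := by
  have : (1 : ℝ) ≤ √(1 + ‖x - a‖ ^ 2) := Real.one_le_sqrt.2 (by nlinarith [sq_nonneg ‖x - a‖])
  unfold softDist; linarith

theorem softDist_self {d : ℕ} (a : Eucl d) : softDist a a = 0 := by simp [softDist]

theorem norm_sub_le_softDist {d : ℕ} (a x : Eucl d) : ‖x - a‖ - 1 ≤ softDist a x := by
  have : ‖x - a‖ ≤ √(1 + ‖x - a‖ ^ 2) := Real.le_sqrt_of_sq_le (by linarith)
  unfold softDist; linarith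

theorem contDiff_softDist {d : ℕ} (a : Eucl d) : ContDiff ℝ 1 (softDist a) := by
  unfold softDist
  refine ContDiff.sub (ContDiff.sqrt ?_ fun x => by positivity) contDiff_const
  exact contDiff_const.add ((contDiff_id.sub contDiff_const).norm_sq ℝ)

/-- The soft distance has a gradient of norm at most one everywhere. -/
theorem exists_hasGradientAt_softDist {d : ℕ} (a x : Eucl d) :
    ∃ q : Eucl d, ‖q‖ ≤ 1 ∧ HasGradientAt (softDist a) q x := by
  have hpos : 0 < 1 + ‖x - a‖ ^ 2 := by positivity
  have h1 : HasDerivAt (fun s : ℝ => √(1 + s) - 1) (1 / (2 * √(1 + ‖x - a‖ ^ 2)))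
      (‖x - a‖ ^ 2) :=
    (((hasDerivAt_id (‖x - a‖ ^ 2)).const_add 1).sqrt hpos.ne').sub_const 1
  refine ⟨_, ?_, HasGradientAt.comp_real h1 (hasGradientAt_normSq_sub a x)⟩
  have hs : 0 < √(1 + ‖x - a‖ ^ 2) := Real.sqrt_pos.2 hpos
  have : ‖x - a‖ ≤ √(1 + ‖x - a‖ ^ 2) := Real.le_sqrt_of_sq_le (by linarith)
  rw [smul_smul, norm_smul, Real.norm_of_nonneg (by positivity)]
  rw [show 1 / (2 * √(1 + ‖x - a‖ ^ 2)) * 2 * ‖x - a‖ = ‖x - a‖ / √(1 + ‖x - a‖ ^ 2) by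
    field_simp]
  exact (div_le_one hs).2 this

/-- The left-hand side `φ_t + H(Dφ, x, t)` of the equation, for a smooth function `φ`. -/
noncomputable def hjOp {d : ℕ} (H : Eucl d → Eucl d → ℝ → ℝ) (φ : Eucl d × ℝ → ℝ)
    (z : Eucl d × ℝ) : ℝ :=
  deriv (fun s => φ (z.1, s)) z.2 + H (gradient (fun y => φ (y, z.2)) z.1) z.1 z.2

theorem IsViscositySubsolution.hjOp_nonpos {d : ℕ} {H : Eucl d → Eucl d → ℝ → ℝ}
    {u : Eucl d × ℝ → ℝ} (hu : IsViscositySubsolution H u) {φ : Eucl d × ℝ → ℝ}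
    (hφ : ContDiff ℝ 1 φ) {z : Eucl d × ℝ} (hz : 0 < z.2)
    (hmax : IsLocalMax (fun z => u z - φ z) z) : hjOp H φ z ≤ 0 :=
  hu φ hφ z.1 z.2 hz hmax

theorem IsViscositySupersolution.hjOp_nonneg {d : ℕ} {H : Eucl d → Eucl d → ℝ → ℝ}
    {u : Eucl d × ℝ → ℝ} (hu : IsViscositySupersolution H u) {φ : Eucl d × ℝ → ℝ}
    (hφ : ContDiff ℝ 1 φ) {z : Eucl d × ℝ} (hz : 0 < z.2)
    (hmin : IsLocalMin (fun z => u z - φ z) z) : 0 ≤ hjOp H φ z :=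
  hu φ hφ z.1 z.2 hz hmin

theorem hjOp_eq {d : ℕ} (H : Eucl d → Eucl d → ℝ → ℝ) {φ : Eucl d × ℝ → ℝ}
    {x : Eucl d} {t a : ℝ} {p : Eucl d} (ht : HasDerivAt (fun s => φ (x, s)) a t)
    (hx : HasGradientAt (fun y => φ (y, t)) p x) : hjOp H φ (x, t) = a + H p x t := by
  simp only [hjOp, ht.deriv, hx.gradient]

theorem ContDiff.hasDerivAt_time {d : ℕ} {φ : Eucl d × ℝ → ℝ} (hφ : ContDiff ℝ 1 φ)
    (z : Eucl d × ℝ) : HasDerivAt (fun s => φ (z.1, s)) (fderiv ℝ φ z (0, 1)) z.2 := by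
  have h1 : HasFDerivAt φ (fderiv ℝ φ z) (z.1, z.2) :=
    ((hφ.differentiable one_ne_zero) z).hasFDerivAt
  exact h1.comp_hasDerivAt z.2 ((hasDerivAt_const z.2 z.1).prodMk (hasDerivAt_id z.2))

theorem ContDiff.hasGradientAt_space {d : ℕ} {φ : Eucl d × ℝ → ℝ} (hφ : ContDiff ℝ 1 φ)
    (z : Eucl d × ℝ) : HasGradientAt (fun y => φ (y, z.2))
      ((InnerProductSpace.toDual ℝ (Eucl d)).symm
        ((fderiv ℝ φ z).comp (ContinuousLinearMap.inl ℝ (Eucl d) ℝ))) z.1 := by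
  have h1 : HasFDerivAt φ (fderiv ℝ φ z) (z.1, z.2) :=
    ((hφ.differentiable one_ne_zero) z).hasFDerivAt
  rw [hasGradientAt_iff_hasFDerivAt]
  have h2 := h1.comp z.1 (hasFDerivAt_prodMk_left (𝕜 := ℝ) z.1 z.2)
  exact h2.congr_fderiv (LinearIsometryEquiv.apply_symm_apply _ _).symm

theorem hjOp_eq_fderiv {d : ℕ} (H : Eucl d → Eucl d → ℝ → ℝ) {φ : Eucl d × ℝ → ℝ}
    (hφ : ContDiff ℝ 1 φ) (z : Eucl d × ℝ) : hjOp H φ z = fderiv ℝ φ z (0, 1) +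
      H ((InnerProductSpace.toDual ℝ (Eucl d)).symm
        ((fderiv ℝ φ z).comp (ContinuousLinearMap.inl ℝ (Eucl d) ℝ))) z.1 z.2 :=
  hjOp_eq H (hφ.hasDerivAt_time z) (hφ.hasGradientAt_space z)

theorem continuous_hjOp {d : ℕ} {H : Eucl d → Eucl d → ℝ → ℝ}
    (hH : Continuous fun q : Eucl d × Eucl d × ℝ => H q.1 q.2.1 q.2.2)
    {φ : Eucl d × ℝ → ℝ} (hφ : ContDiff ℝ 1 φ) : Continuous (hjOp H φ) := by
  have hc : Continuous (fderiv ℝ φ) := hφ.continuous_fderiv one_ne_zero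
  rw [funext (hjOp_eq_fderiv H hφ)]
  refine (hc.clm_apply continuous_const).add (hH.comp (Continuous.prodMk ?_ continuous_id))
  exact (LinearIsometryEquiv.continuous _).comp (hc.clm_comp continuous_const)

/-- The squared Euclidean distance in space-time. -/
noncomputable def sqDist {d : ℕ} (z₀ z : Eucl d × ℝ) : ℝ := ‖z.1 - z₀.1‖ ^ 2 + (z.2 - z₀.2) ^ 2

theorem contDiff_sqDist {d : ℕ} (z₀ : Eucl d × ℝ) : ContDiff ℝ 1 (sqDist z₀) := by
  unfold sqDist
  exact ((contDiff_fst.sub contDiff_const).norm_sq ℝ).add ((contDiff_snd.sub contDiff_const).pow 2)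

theorem sqDist_self {d : ℕ} (z₀ : Eucl d × ℝ) : sqDist z₀ z₀ = 0 := by simp [sqDist]

theorem sq_dist_le_sqDist {d : ℕ} (z₀ z : Eucl d × ℝ) : dist z z₀ ^ 2 ≤ sqDist z₀ z := by
  rw [Prod.dist_eq, dist_eq_norm, Real.dist_eq, sqDist]
  rcases max_cases ‖z.1 - z₀.1‖ |z.2 - z₀.2| with h | h <;> rw [h.1]
  · nlinarith [sq_nonneg (z.2 - z₀.2)]
  · rw [sq_abs]; nlinarith [sq_nonneg ‖z.1 - z₀.1‖]

/-- Adding a multiple of the squared distance to `z₀` and a constant does not change the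
operator at `z₀`. -/
theorem hjOp_add_sqDist {d : ℕ} (H : Eucl d → Eucl d → ℝ → ℝ) {φ : Eucl d × ℝ → ℝ}
    (hφ : ContDiff ℝ 1 φ) (z₀ : Eucl d × ℝ) (c k : ℝ) :
    hjOp H (fun z => φ z + (c * sqDist z₀ z + k)) z₀ = hjOp H φ z₀ := by
  have h1 := hφ.hasDerivAt_time z₀
  have h2 := hφ.hasGradientAt_space z₀
  rw [show hjOp H φ z₀ = _ from hjOp_eq H h1 h2]
  refine hjOp_eq H (x := z₀.1) (t := z₀.2) ?_ ?_
  · have h3 : HasDerivAt (fun s : ℝ => c * sqDist z₀ (z₀.1, s) + k) 0 z₀.2 := by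
      have := ((((hasDerivAt_id z₀.2).sub_const z₀.2).pow 2).const_add
        (‖z₀.1 - z₀.1‖ ^ 2)).const_mul c |>.add_const k
      simpa [sqDist] using this
    exact (h1.add h3).congr_deriv (add_zero _)
  · have h3 : HasGradientAt (fun y => c * sqDist z₀ (y, z₀.2) + k) 0 z₀.1 := by
      have hg : HasDerivAt (fun s : ℝ => c * (s + (z₀.2 - z₀.2) ^ 2) + k) c (‖z₀.1 - z₀.1‖ ^ 2) := by
        exact ((((hasDerivAt_id _).add_const ((z₀.2 - z₀.2) ^ 2)).const_mul c).add_const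
          k).congr_deriv (mul_one c)
      simpa [sqDist] using HasGradientAt.comp_real hg (hasGradientAt_normSq_sub z₀.1 z₀.1)
    simpa using h2.add' h3

/-- The Hamiltonian of the equation solved by `-u`. -/
def dualHamiltonian {d : ℕ} (H : Eucl d → Eucl d → ℝ → ℝ) : Eucl d → Eucl d → ℝ → ℝ :=
  fun p x t => -H (-p) x t

theorem hjOp_neg {d : ℕ} (H : Eucl d → Eucl d → ℝ → ℝ) {φ : Eucl d × ℝ → ℝ}
    (hφ : ContDiff ℝ 1 φ) (z : Eucl d × ℝ) :
    hjOp H (fun z => -φ z) z = -hjOp (dualHamiltonian H) φ z := by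
  have h1 := hφ.hasDerivAt_time z
  have h2 := hφ.hasGradientAt_space z
  rw [show hjOp (dualHamiltonian H) φ z = _ from hjOp_eq _ h1 h2]
  have h3 : HasGradientAt (fun y => -φ (y, z.2)) _ z.1 :=
    HasGradientAt.comp_real (f := fun y => φ (y, z.2)) (g := fun s => -s) (hasDerivAt_neg _) h2
  rw [show hjOp H (fun z => -φ z) z = _ from hjOp_eq H (x := z.1) (t := z.2) h1.neg h3]
  simp only [dualHamiltonian, neg_smul, one_smul]
  ring

theorem IsViscositySupersolution.neg {d : ℕ} {H : Eucl d → Eucl d → ℝ → ℝ}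
    {v : Eucl d × ℝ → ℝ} (hv : IsViscositySupersolution H v) :
    IsViscositySubsolution (dualHamiltonian H) fun z => -v z := by
  intro φ hφ x t ht hmax
  have h1 := hv (fun z => -φ z) hφ.neg x t ht (by
    filter_upwards [hmax] with y hy
    linarith)
  change 0 ≤ hjOp H (fun z => -φ z) (x, t) at h1
  change hjOp (dualHamiltonian H) φ (x, t) ≤ 0
  rw [hjOp_neg H hφ] at h1
  linarith

theorem IsViscositySubsolution.neg {d : ℕ} {H : Eucl d → Eucl d → ℝ → ℝ}
    {v : Eucl d × ℝ → ℝ} (hv : IsViscositySubsolution H v) :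
    IsViscositySupersolution (dualHamiltonian H) fun z => -v z := by
  intro φ hφ x t ht hmin
  have h1 := hv (fun z => -φ z) hφ.neg x t ht (by
    filter_upwards [hmin] with y hy
    linarith)
  change hjOp H (fun z => -φ z) (x, t) ≤ 0 at h1
  change 0 ≤ hjOp (dualHamiltonian H) φ (x, t)
  rw [hjOp_neg H hφ] at h1
  linarith

/-! ### Comparison with smooth strict supersolutions -/

theorem isCompact_slab {d : ℕ} (R T : ℝ) :
    IsCompact (Metric.closedBall (0 : Eucl d) R ×ˢ Set.Icc (0 : ℝ) T) :=
  (isCompact_closedBall _ _).prod isCompact_Icc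

/-- A subsolution stays below a `C¹` function `S` which it touches from above only at points where
`S` is a strict supersolution. -/
theorem IsViscositySubsolution.le_of_strict {d : ℕ} {H : Eucl d → Eucl d → ℝ → ℝ}
    {u S : Eucl d × ℝ → ℝ} (hsub : IsViscositySubsolution H u) (hu : UpperSemicontinuous u)
    (hS : ContDiff ℝ 1 S) {T R : ℝ}
    (h0 : ∀ x, u (x, 0) ≤ S (x, 0)) (hT : ∀ x, u (x, T) ≤ S (x, T))
    (hR : ∀ x t, 0 ≤ t → t ≤ T → R < ‖x‖ → u (x, t) ≤ S (x, t))
    (hstrict : ∀ x t, 0 < t → t < T → S (x, t) < u (x, t) → 0 < hjOp H S (x, t))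
    (x : Eucl d) (t : ℝ) (ht0 : 0 ≤ t) (htT : t ≤ T) : u (x, t) ≤ S (x, t) := by
  by_contra! hlt
  set K : Set (Eucl d × ℝ) := Metric.closedBall (0 : Eucl d) R ×ˢ Set.Icc (0 : ℝ) T with hK
  have mem : ∀ y s, 0 ≤ s → s ≤ T → S (y, s) < u (y, s) → (y, s) ∈ K := by
    intro y s hs0 hsT hys
    refine ⟨?_, hs0, hsT⟩
    by_contra hy
    have hy : R < ‖y‖ := by simpa using hy
    exact absurd (hR y s hs0 hsT hy) (not_le.2 hys)
  have husc : UpperSemicontinuous fun z => u z + -S z :=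
    hu.add hS.continuous.neg.upperSemicontinuous
  obtain ⟨⟨y, s⟩, hmem, hmax⟩ := UpperSemicontinuousOn.exists_isMaxOn
    ⟨_, mem x t ht0 htT hlt⟩ (isCompact_slab R T) (husc.upperSemicontinuousOn K)
  have hpos : S (y, s) < u (y, s) := by
    have : u (x, t) + -S (x, t) ≤ u (y, s) + -S (y, s) := hmax (mem x t ht0 htT hlt)
    linarith
  have hs0 : 0 < s := by
    refine lt_of_le_of_ne hmem.2.1 fun h => ?_
    subst h
    exact absurd (h0 y) (not_le.2 hpos)
  have hsT : s < T := by
    refine lt_of_le_of_ne hmem.2.2 fun h => ?_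
    subst h
    exact absurd (hT y) (not_le.2 hpos)
  have hloc : IsLocalMax (fun z => u z - S z) (y, s) := by
    have : ∀ᶠ z : Eucl d × ℝ in 𝓝 (y, s), 0 < z.2 ∧ z.2 < T :=
      (continuous_snd.tendsto (y, s)).eventually (Ioo_mem_nhds hs0 hsT)
    filter_upwards [this] with z hz
    by_cases hz' : S z < u z
    · have : u z + -S z ≤ u (y, s) + -S (y, s) := hmax (mem z.1 z.2 hz.1.le hz.2.le hz')
      linarith
    · linarith
  have h1 := hsub S hS y s hs0 hloc
  exact absurd (hstrict y s hs0 hsT hpos) (not_lt.2 h1)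

/-- A subsolution of `u_t + h(Du) = V` below `ξ₀ · x` at time zero, and above it by at
most a constant on bounded time intervals, stays below `ξ₀ · x + M t`, with an explicit `M`. -/
theorem IsViscositySubsolution.le_linear {d : ℕ} {h : Eucl d → ℝ} {V : Eucl d → ℝ → ℝ}
    {ξ₀ : Eucl d} {M : ℝ} (hM : ∀ q x t, ‖q‖ ≤ 1 → V x t ≤ M + h (ξ₀ + q))
    {u : Eucl d × ℝ → ℝ} (hsub : IsViscositySubsolution (fun ξ x t => h ξ - V x t) u)
    (hu : UpperSemicontinuous u) (h0 : ∀ x, u (x, 0) ≤ inner ℝ ξ₀ x)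
    (hb : ∀ T : ℝ, ∃ C : ℝ, ∀ x t, 0 ≤ t → t ≤ T → u (x, t) ≤ inner ℝ ξ₀ x + C)
    (x : Eucl d) (t : ℝ) (ht : 0 ≤ t) : u (x, t) ≤ inner ℝ ξ₀ x + M * t := by
  refine le_of_forall_pos_le_add fun σ hσ => ?_
  obtain ⟨C, hC⟩ := hb (t + 1)
  set N : ℝ := |C| / σ + |M| * (t + 1) / σ + 1 with hN
  have hN0 : 0 < N := by positivity
  -- the exponential is tiny up to time `t` and beats the bound `C` at time `t + 1`
  have hexp : C ≤ M * (t + 1) + σ * Real.exp N := by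
    have h1 : N + 1 ≤ Real.exp N := Real.add_one_le_exp N
    have h2 : σ * N = |C| + |M| * (t + 1) + σ := by rw [hN]; field_simp
    have h3 : -(|M| * (t + 1)) ≤ M * (t + 1) := by
      nlinarith [neg_abs_le M]
    nlinarith [le_abs_self C, mul_le_mul_of_nonneg_left h1 hσ.le]
  set S : Eucl d × ℝ → ℝ := fun z =>
    inner ℝ ξ₀ z.1 + M * z.2 + softDist x z.1 + σ * Real.exp (N * (z.2 - t)) with hSdef
  have hS : ContDiff ℝ 1 S := by
    refine ContDiff.add (ContDiff.add (ContDiff.add ?_ ?_) ?_) ?_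
    · exact contDiff_const.inner ℝ contDiff_fst
    · exact contDiff_const.mul contDiff_snd
    · exact (contDiff_softDist x).comp contDiff_fst
    · fun_prop
  have key := hsub.le_of_strict (T := t + 1) (R := ‖x‖ + 1 + |C| + |M| * (t + 1)) hu hS ?_ ?_ ?_ ?_
    x t ht (by linarith)
  · simpa [hSdef, softDist_self] using key
  · intro y
    have h1 := h0 y
    have h2 := softDist_nonneg x y
    have h3 := mul_pos hσ (Real.exp_pos (N * (0 - t)))
    simp only [hSdef]
    linarith
  · intro y
    have h1 := hC y (t + 1) (by linarith) le_rfl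
    have h2 := softDist_nonneg x y
    simp only [hSdef]
    rw [show N * (t + 1 - t) = N by ring]
    linarith
  · intro y s hs0 hsT hy
    have h1 := hC y s hs0 hsT
    have h2 := norm_sub_le_softDist x y
    have h3 := mul_pos hσ (Real.exp_pos (N * (s - t)))
    have h4 := norm_sub_norm_le y x
    have h5 : -(|M| * (t + 1)) ≤ M * s := by
      have : |M| * s ≤ |M| * (t + 1) := mul_le_mul_of_nonneg_left hsT (abs_nonneg _)
      nlinarith [neg_abs_le M]
    simp only [hSdef]
    linarith [le_abs_self C]
  · intro y s hs0 hsT _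
    obtain ⟨q, hq, hq'⟩ := exists_hasGradientAt_softDist x y
    have ht' : HasDerivAt (fun r => S (y, r)) (M + σ * (Real.exp (N * (s - t)) * N)) s := by
      have h1 : HasDerivAt (fun r : ℝ => N * (r - t)) N s := by
        simpa using ((hasDerivAt_id s).sub_const t).const_mul N
      have h2 := ((((hasDerivAt_id s).const_mul M).const_add (inner ℝ ξ₀ y)).add_const
        (softDist x y)).add (h1.exp.const_mul σ)
      exact h2.congr_deriv (by simp)
    have hx' : HasGradientAt (fun w => S (w, s)) (ξ₀ + q) y := by
      have h1 := ((hasGradientAt_inner ξ₀ y).add' (hasGradientAt_const' (M * s) y)).add' hq'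
      have h2 := h1.add' (hasGradientAt_const' (σ * Real.exp (N * (s - t))) y)
      simp only [add_zero] at h2
      exact h2
    rw [hjOp_eq _ ht' hx']
    have h1 := hM q y s hq
    have h2 : 0 < σ * (Real.exp (N * (s - t)) * N) := by positivity
    linarith

/-! ### The comparison principle -/

/-- A continuous function is uniformly continuous near a ball. -/
theorem exists_pos_abs_sub_lt {d : ℕ} {h : Eucl d → ℝ} (hh : Continuous h) (P : ℝ) {ε : ℝ}
    (hε : 0 < ε) :
    ∃ β > 0, ∀ p q : Eucl d, ‖p‖ ≤ P → ‖q‖ ≤ β → |h (p + q) - h p| < ε := by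
  have huc := (isCompact_closedBall (0 : Eucl d) (P + 1)).uniformContinuousOn_of_continuous
    hh.continuousOn
  obtain ⟨β, hβ, hβ'⟩ := Metric.uniformContinuousOn_iff.1 huc ε hε
  refine ⟨min (β / 2) 1, by positivity, fun p q hp hq => ?_⟩
  have h1 : ‖q‖ ≤ β / 2 := hq.trans (min_le_left _ _)
  have h2 : ‖q‖ ≤ 1 := hq.trans (min_le_right _ _)
  have h3 := norm_add_le p q
  have := hβ' (p + q) (by simp; linarith) p (by simp; linarith) (by simp; linarith)
  rwa [Real.dist_eq] at this

/-- The distance of the doubled points below which the initial data and the values of the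
potential cannot account for the excess `δ`. -/
theorem exists_small_radius {A L δ γ : ℝ} (hA0 : 0 ≤ A) (hL : 0 ≤ L) (hδ0 : 0 < δ)
    (hγ0 : 0 < γ) : ∃ ρ > 0, A * ρ < δ / 2 ∧ L * (ρ + ρ) ≤ γ / 2 := by
  refine ⟨min (δ / (4 * (A + 1))) (γ / (4 * (L + 1))), by positivity, ?_, ?_⟩
  · calc A * min (δ / (4 * (A + 1))) (γ / (4 * (L + 1))) ≤ A * (δ / (4 * (A + 1))) := by
          gcongr; exact min_le_left _ _
      _ < δ / 2 := by
          rw [mul_div_assoc', div_lt_div_iff₀ (by positivity) (by positivity)]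
          nlinarith
  · calc L * (min (δ / (4 * (A + 1))) (γ / (4 * (L + 1))) +
            min (δ / (4 * (A + 1))) (γ / (4 * (L + 1))))
          ≤ L * (γ / (4 * (L + 1)) + γ / (4 * (L + 1))) := by
          gcongr <;> exact min_le_right _ _
      _ ≤ γ / 2 := by
          rw [← add_div, mul_div_assoc', div_le_div_iff₀ (by positivity) (by positivity)]
          nlinarith

/-- The weight `β` of the penalization at infinity: its contribution to the gradient, at momenta
bounded by `P`, is absorbed by the gain `γ` in the time derivative. -/
theorem exists_small_weight {d : ℕ} {h : Eucl d → ℝ} (hh : Continuous h) (P : ℝ) {γ δ θ : ℝ}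
    (hγ0 : 0 < γ) (hδ0 : 0 < δ) (hs : 0 ≤ θ) : ∃ β > 0, β * θ ≤ δ / 4 ∧
      ∀ p q : Eucl d, ‖p‖ ≤ P → ‖q‖ ≤ β → |h (p + q) - h p| < γ / 2 := by
  obtain ⟨β, hβ0, hβ⟩ := exists_pos_abs_sub_lt hh P (half_pos hγ0)
  refine ⟨min β (δ / (4 * (θ + 1))), by positivity, ?_,
    fun p q hp hq => hβ p q hp (hq.trans (min_le_left _ _))⟩
  calc min β (δ / (4 * (θ + 1))) * θ
      ≤ δ / (4 * (θ + 1)) * θ := by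
        gcongr; exact min_le_right _ _
    _ ≤ δ / 4 := by
        rw [div_mul_eq_mul_div, div_le_div_iff₀ (by positivity) (by positivity)]
        nlinarith

/-- The a-priori estimates in the doubling of variables: where the penalized difference is
positive, the two points are close to each other, and the penalizations are bounded. -/
theorem doubling_bound {A M D t n γ b : ℝ} (hn : 1 ≤ n) (hγ : 0 < γ) (ht : 0 ≤ t) (hb : 0 ≤ b)
    (h : n / 2 * D ^ 2 + b + γ * (t + t ^ 2) ≤ A * D + 2 * M * t) :
    n * D ^ 2 ≤ 4 * (A ^ 2 + M ^ 2 / γ) ∧ b ≤ A ^ 2 + M ^ 2 / γ ∧ γ * t ≤ A ^ 2 + M ^ 2 / γ := by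
  have h1 : 2 * M * t ≤ γ * t ^ 2 + M ^ 2 / γ := by
    have : γ * t ^ 2 + M ^ 2 / γ - 2 * M * t = (γ * t - M) ^ 2 / γ := by field_simp; ring
    have h2 : 0 ≤ (γ * t - M) ^ 2 / γ := by positivity
    linarith
  have h2 : A * D ≤ n / 4 * D ^ 2 + A ^ 2 := by
    nlinarith [sq_nonneg (D / 2 - A), sq_nonneg D]
  have h3 : 0 ≤ n * D ^ 2 := by positivity
  have h4 : 0 ≤ γ * t := by positivity
  refine ⟨?_, ?_, ?_⟩ <;> nlinarith

/-- The equation evaluated at the penalization, as a function of the first point. -/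
theorem hjOp_penalization_left {d : ℕ} (h : Eucl d → ℝ) (V : Eucl d → ℝ → ℝ) (n β γ : ℝ)
    (x y : Eucl d) (t s : ℝ) {q : Eucl d} (hq : HasGradientAt (softDist 0) q x) :
    hjOp (fun ξ x t => h ξ - V x t)
      (fun z => n / 2 * sqDist (y, s) z + β * softDist 0 z.1 + γ * (z.2 + z.2 ^ 2)) (x, t) =
      n * (t - s) + γ * (1 + 2 * t) + (h (n • (x - y) + β • q) - V x t) := by
  refine hjOp_eq _ ?_ ?_
  · have h1 := (((((hasDerivAt_id t).sub_const s).pow 2).const_add (‖x - y‖ ^ 2)).const_mul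
      (n / 2)).add_const (β * softDist 0 x)
    have h2 := ((hasDerivAt_id t).add ((hasDerivAt_id t).pow 2)).const_mul γ
    exact (h1.add h2).congr_deriv (by simp; ring)
  · have g1 : HasDerivAt (fun r : ℝ => n / 2 * (r + (t - s) ^ 2)) (n / 2) (‖x - y‖ ^ 2) :=
      (((hasDerivAt_id _).add_const ((t - s) ^ 2)).const_mul (n / 2)).congr_deriv (mul_one _)
    have g2 : HasDerivAt (fun r : ℝ => β * r) β (softDist 0 x) :=
      ((hasDerivAt_id _).const_mul β).congr_deriv (mul_one _)
    have h1 := ((HasGradientAt.comp_real g1 (hasGradientAt_normSq_sub y x)).add'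
      (HasGradientAt.comp_real g2 hq)).add' (hasGradientAt_const' (γ * (t + t ^ 2)) x)
    rw [add_zero, smul_smul, show n / 2 * 2 = n by ring] at h1
    exact h1

/-- The equation evaluated at the penalization, as a function of the second point. -/
theorem hjOp_penalization_right {d : ℕ} (h : Eucl d → ℝ) (V : Eucl d → ℝ → ℝ) (n : ℝ)
    (x y : Eucl d) (t s : ℝ) :
    hjOp (fun ξ x t => h ξ - V x t) (fun z => -(n / 2) * sqDist (x, t) z) (y, s) =
      n * (t - s) + (h (n • (x - y)) - V y s) := by
  refine hjOp_eq _ ?_ ?_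
  · have h1 := ((((hasDerivAt_id s).sub_const t).pow 2).const_add (‖y - x‖ ^ 2)).const_mul
      (-(n / 2))
    exact h1.congr_deriv (by simp; ring)
  · have g1 : HasDerivAt (fun r : ℝ => -(n / 2) * (r + (s - t) ^ 2)) (-(n / 2)) (‖y - x‖ ^ 2) :=
      (((hasDerivAt_id _).add_const ((s - t) ^ 2)).const_mul (-(n / 2))).congr_deriv (mul_one _)
    have h1 := HasGradientAt.comp_real g1 (hasGradientAt_normSq_sub x y)
    rw [smul_smul, show -(n / 2) * 2 = -n by ring, neg_smul, ← smul_neg, neg_sub] at h1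
    exact h1

set_option maxHeartbeats 1000000 in
/-- **Comparison principle**: a semicontinuous subsolution and a semicontinuous supersolution
whose distance to `ξ₀ · x` is at most linear in time are ordered. -/
theorem comparison {d : ℕ} {h : Eucl d → ℝ} (hh : Continuous h) {V : Eucl d → ℝ → ℝ} {L : ℝ}
    (hL : 0 ≤ L) (hV : ∀ x y t s, |V x t - V y s| ≤ L * (‖x - y‖ + |t - s|))
    {u v : Eucl d × ℝ → ℝ} (hu : UpperSemicontinuous u) (hv : LowerSemicontinuous v)
    (hsub : IsViscositySubsolution (fun ξ x t => h ξ - V x t) u)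
    (hsuper : IsViscositySupersolution (fun ξ x t => h ξ - V x t) v) {ξ₀ : Eucl d} {M : ℝ}
    (hM : 0 ≤ M) (hub : ∀ x t, 0 ≤ t → u (x, t) ≤ inner ℝ ξ₀ x + M * t)
    (hvb : ∀ x t, 0 ≤ t → inner ℝ ξ₀ x - M * t ≤ v (x, t)) (x₁ : Eucl d) (t₁ : ℝ) (ht₁ : 0 ≤ t₁) :
    u (x₁, t₁) ≤ v (x₁, t₁) := by
  by_contra! hlt
  set δ := u (x₁, t₁) - v (x₁, t₁) with hδ
  have hδ0 : 0 < δ := sub_pos.2 hlt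
  set A := ‖ξ₀‖ + M with hA
  have hA0 : 0 ≤ A := by positivity
  obtain ⟨γ, hγ0, hγ⟩ : ∃ γ > 0, γ * (t₁ + t₁ ^ 2) ≤ δ / 4 := by
    refine ⟨δ / (4 * (t₁ + t₁ ^ 2 + 1)), by positivity, ?_⟩
    rw [div_mul_eq_mul_div, div_le_div_iff₀ (by positivity) (by positivity)]
    nlinarith
  set E := A ^ 2 + M ^ 2 / γ with hE
  have hE0 : 0 ≤ E := by positivity
  obtain ⟨ρ, hρ0, hρA, hρL⟩ := exists_small_radius hA0 hL hδ0 hγ0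
  obtain ⟨n, hn1, hn⟩ : ∃ n : ℝ, 1 ≤ n ∧ 4 * E ≤ n * ρ ^ 2 := by
    refine ⟨max 1 (4 * E / ρ ^ 2), le_max_left _ _, ?_⟩
    calc 4 * E = 4 * E / ρ ^ 2 * ρ ^ 2 := by field_simp
      _ ≤ _ := by gcongr; exact le_max_right _ _
  obtain ⟨β, hβ0, hβx, hβ⟩ := exists_small_weight hh (n * ρ) hγ0 hδ0 (softDist_nonneg 0 x₁)
  -- the order of the choices matters: the momentum `n (x - y)` is bounded by `n ρ` before the
  -- weight `β` is chosen, so that local uniform continuity of `h` is enough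
  set Φ : (Eucl d × ℝ) × (Eucl d × ℝ) → ℝ := fun q => u q.1 + -v q.2 +
    -(n / 2 * sqDist q.2 q.1 + β * softDist 0 q.1.1 + γ * (q.1.2 + q.1.2 ^ 2)) with hΦ
  have husc : UpperSemicontinuous Φ := by
    refine ((hu.comp continuous_fst).add (hv.comp continuous_snd).neg).add
      (Continuous.upperSemicontinuous ?_)
    have h1 : Continuous fun q : (Eucl d × ℝ) × (Eucl d × ℝ) => sqDist q.2 q.1 := by
      unfold sqDist; fun_prop
    have h2 : Continuous fun q : (Eucl d × ℝ) × (Eucl d × ℝ) => softDist 0 q.1.1 :=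
      (contDiff_softDist 0).continuous.comp (by fun_prop)
    fun_prop
  -- the estimates where `Φ` is positive
  have est : ∀ x t y s, 0 ≤ t → 0 ≤ s → 0 < Φ ((x, t), (y, s)) →
      ‖x - y‖ ≤ ρ ∧ |t - s| ≤ ρ ∧ β * softDist 0 x ≤ E ∧ γ * t ≤ E := by
    intro x t y s ht hs hpos
    obtain ⟨D, hD0, hD⟩ : ∃ D, 0 ≤ D ∧ D ^ 2 = sqDist (y, s) (x, t) :=
      ⟨√(sqDist (y, s) (x, t)), Real.sqrt_nonneg _, Real.sq_sqrt (by unfold sqDist; positivity)⟩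
    have hDx : ‖x - y‖ ≤ D := by
      refine le_of_sq_le_sq ?_ hD0
      rw [hD]; simp only [sqDist]; nlinarith [sq_nonneg (t - s)]
    have hDt : |t - s| ≤ D := by
      refine abs_le_of_sq_le_sq ?_ hD0
      rw [hD]; simp only [sqDist]; nlinarith [sq_nonneg ‖x - y‖]
    have h1 := hub x t ht
    have h2 := hvb y s hs
    have h3 : inner ℝ ξ₀ x - inner ℝ ξ₀ y ≤ ‖ξ₀‖ * D := by
      rw [← inner_sub_right]
      exact (real_inner_le_norm _ _).trans (by gcongr)
    have h4 : M * s ≤ M * (t + D) := by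
      gcongr
      linarith [neg_abs_le (t - s)]
    have h5 : n / 2 * D ^ 2 + β * softDist 0 x + γ * (t + t ^ 2) ≤ A * D + 2 * M * t := by
      simp only [hΦ, ← hD] at hpos
      rw [hA]
      linarith
    obtain ⟨e1, e2, e3⟩ := doubling_bound hn1 hγ0 ht
      (mul_nonneg hβ0.le (softDist_nonneg 0 x)) h5
    have hDρ : D ≤ ρ := by
      refine le_of_sq_le_sq ?_ hρ0.le
      have : n * D ^ 2 ≤ n * ρ ^ 2 := e1.trans hn
      exact le_of_mul_le_mul_left this (by linarith)
    exact ⟨hDx.trans hDρ, hDt.trans hDρ, e2, e3⟩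
  set K : Set ((Eucl d × ℝ) × (Eucl d × ℝ)) :=
    (Metric.closedBall (0 : Eucl d) (E / β + 1) ×ˢ Set.Icc (0 : ℝ) (E / γ)) ×ˢ
    (Metric.closedBall (0 : Eucl d) (E / β + 1 + ρ) ×ˢ Set.Icc (0 : ℝ) (E / γ + ρ)) with hK
  have mem : ∀ x t y s, 0 ≤ t → 0 ≤ s → 0 < Φ ((x, t), (y, s)) → ((x, t), (y, s)) ∈ K := by
    intro x t y s ht hs hpos
    obtain ⟨e1, e2, e3, e4⟩ := est x t y s ht hs hpos
    have e5 : ‖x‖ ≤ E / β + 1 := by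
      have h1 := norm_sub_le_softDist 0 x
      rw [sub_zero] at h1
      have h2 : softDist 0 x ≤ E / β := by rw [le_div_iff₀ hβ0]; linarith
      linarith
    have e6 : t ≤ E / γ := by rw [le_div_iff₀ hγ0]; linarith
    have e7 : ‖y‖ ≤ ‖x‖ + ‖x - y‖ := by
      have := norm_sub_norm_le y x
      rw [norm_sub_rev] at this
      linarith
    refine ⟨⟨by simpa using e5, ht, e6⟩, by simp; linarith, hs, ?_⟩
    change s ≤ _
    linarith [neg_abs_le (t - s)]
  have hval : δ / 2 ≤ Φ ((x₁, t₁), (x₁, t₁)) := by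
    simp only [hΦ, sqDist_self]
    linarith
  obtain ⟨⟨⟨x, t⟩, ⟨y, s⟩⟩, hmem, hmax⟩ := UpperSemicontinuousOn.exists_isMaxOn
    ⟨_, mem x₁ t₁ x₁ t₁ ht₁ ht₁ (by linarith)⟩
    (((isCompact_slab _ _).prod (isCompact_slab _ _)) : IsCompact K) (husc.upperSemicontinuousOn K)
  have hge : δ / 2 ≤ Φ ((x, t), (y, s)) :=
    hval.trans (hmax (mem x₁ t₁ x₁ t₁ ht₁ ht₁ (by linarith)))
  have ht : 0 ≤ t := hmem.1.2.1
  have hs : 0 ≤ s := hmem.2.2.1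
  have hmax' : ∀ x' t' y' s', 0 ≤ t' → 0 ≤ s' →
      Φ ((x', t'), (y', s')) ≤ Φ ((x, t), (y, s)) := by
    intro x' t' y' s' ht' hs'
    by_cases hp : 0 < Φ ((x', t'), (y', s'))
    · exact hmax (mem _ _ _ _ ht' hs' hp)
    · linarith
  obtain ⟨e1, e2, -, -⟩ := est x t y s ht hs (by linarith)
  have hle : Φ ((x, t), (y, s)) ≤ u (x, t) - v (y, s) := by
    have h1 : 0 ≤ sqDist (y, s) (x, t) := by unfold sqDist; positivity
    have h2 := softDist_nonneg 0 x
    have h3 : 0 ≤ n / 2 * sqDist (y, s) (x, t) + β * softDist 0 x + γ * (t + t ^ 2) := by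
      positivity
    simp only [hΦ]
    linarith
  have hin : inner ℝ ξ₀ x - inner ℝ ξ₀ y ≤ ‖ξ₀‖ * ρ := by
    rw [← inner_sub_right]
    exact (real_inner_le_norm _ _).trans (by gcongr)
  have hAρ : A * ρ = ‖ξ₀‖ * ρ + M * ρ := by rw [hA]; ring
  have ht0 : 0 < t := by
    refine lt_of_le_of_ne ht fun h0 => ?_
    subst h0
    have h1 := hub x 0 le_rfl
    have h2 := hvb y s hs
    have h3 : M * s ≤ M * ρ := by gcongr; linarith [neg_abs_le (0 - s)]
    linarith
  have hs0 : 0 < s := by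
    refine lt_of_le_of_ne hs fun h0 => ?_
    subst h0
    have h1 := hub x t ht
    have h2 := hvb y 0 le_rfl
    have h3 : M * t ≤ M * ρ := by gcongr; linarith [le_abs_self (t - 0)]
    linarith
  obtain ⟨q, hq, hq'⟩ := exists_hasGradientAt_softDist 0 x
  -- the inequality of the subsolution
  have hSub := hsub.hjOp_nonpos (z := (x, t))
    (φ := fun z => n / 2 * sqDist (y, s) z + β * softDist 0 z.1 + γ * (z.2 + z.2 ^ 2))
    (((contDiff_const.mul (contDiff_sqDist _)).add
      (contDiff_const.mul ((contDiff_softDist 0).comp contDiff_fst))).add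
      (contDiff_const.mul (contDiff_snd.add (contDiff_snd.pow 2)))) ht0 (by
    have : ∀ᶠ z : Eucl d × ℝ in 𝓝 (x, t), 0 < z.2 :=
      (continuous_snd.tendsto (x, t)).eventually (lt_mem_nhds ht0)
    filter_upwards [this] with z hz
    have := hmax' z.1 z.2 y s hz.le hs
    simp only [hΦ] at this
    linarith)
  -- the inequality of the supersolution
  have hSup := hsuper.hjOp_nonneg (z := (y, s)) (φ := fun z => -(n / 2) * sqDist (x, t) z)
    (contDiff_const.mul (contDiff_sqDist _)) hs0 (by
    have : ∀ᶠ z : Eucl d × ℝ in 𝓝 (y, s), 0 < z.2 :=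
      (continuous_snd.tendsto (y, s)).eventually (lt_mem_nhds hs0)
    filter_upwards [this] with z hz
    have := hmax' x t z.1 z.2 ht hz.le
    simp only [hΦ] at this
    have c1 : ∀ z w : Eucl d × ℝ, sqDist z w = sqDist w z := fun z w => by
      simp only [sqDist]; rw [norm_sub_rev]; ring
    rw [c1 (x, t) z, c1 (x, t) (y, s)]
    linarith)
  rw [hjOp_penalization_left h V n β γ x y t s hq'] at hSub
  rw [hjOp_penalization_right h V n x y t s] at hSup
  have hp : ‖n • (x - y)‖ ≤ n * ρ := by
    rw [norm_smul, Real.norm_of_nonneg (by linarith)]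
    gcongr
  have hbq : ‖β • q‖ ≤ β := by
    rw [norm_smul, Real.norm_of_nonneg hβ0.le]
    nlinarith
  have f1 := abs_lt.1 (hβ _ _ hp hbq)
  have f2 := abs_le.1 (hV x y t s)
  have f3 : L * (‖x - y‖ + |t - s|) ≤ L * (ρ + ρ) := by gcongr
  have f4 : 0 ≤ γ * (2 * t) := by positivity
  linarith

/-! ### Semicontinuous envelopes and Perron's method -/

/-- The upper semicontinuous envelope of `u`. -/
noncomputable def upperEnvelope {X : Type*} [TopologicalSpace X] (u : X → ℝ) (z : X) : ℝ :=
  limsup u (𝓝 z)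

section Envelope

variable {X : Type*} [TopologicalSpace X] {u l U : X → ℝ}

theorem isBoundedUnder_le_of_le_continuous (hU : Continuous U) (h : ∀ z, u z ≤ U z) (z : X) :
    IsBoundedUnder (· ≤ ·) (𝓝 z) u := by
  refine isBoundedUnder_of_eventually_le (a := U z + 1) ?_
  filter_upwards [hU.continuousAt.eventually (gt_mem_nhds (lt_add_one (U z)))] with y hy
  exact (h y).trans hy.le

theorem isCoboundedUnder_le_of_continuous_le (hl : Continuous l) (h : ∀ z, l z ≤ u z) (z : X) :
    IsCoboundedUnder (· ≤ ·) (𝓝 z) u := by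
  refine IsBoundedUnder.isCoboundedUnder_le (isBoundedUnder_of_eventually_ge (a := l z - 1) ?_)
  filter_upwards [hl.continuousAt.eventually (lt_mem_nhds (sub_one_lt (l z)))] with y hy
  exact hy.le.trans (h y)

theorem le_upperEnvelope (hU : Continuous U) (h : ∀ z, u z ≤ U z) (z : X) :
    u z ≤ upperEnvelope u z :=
  le_limsup_of_frequently_le (fun hn => hn.self_of_nhds le_rfl)
    (isBoundedUnder_le_of_le_continuous hU h z)

theorem upperEnvelope_le (hl : Continuous l) (hlu : ∀ z, l z ≤ u z) (hU : Continuous U)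
    (h : ∀ z, u z ≤ U z) (z : X) : upperEnvelope u z ≤ U z := by
  refine le_of_forall_gt_imp_ge_of_dense fun c hc => ?_
  refine limsup_le_of_le (isCoboundedUnder_le_of_continuous_le hl hlu z) ?_
  filter_upwards [hU.continuousAt.eventually (gt_mem_nhds hc)] with y hy
  exact (h y).trans hy.le

theorem upperSemicontinuous_upperEnvelope (hl : Continuous l) (hlu : ∀ z, l z ≤ u z)
    (hU : Continuous U) (h : ∀ z, u z ≤ U z) : UpperSemicontinuous (upperEnvelope u) := by
  intro z c hc
  obtain ⟨c', h1, h2⟩ := exists_between hc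
  have h3 : ∀ᶠ y in 𝓝 z, u y < c' :=
    eventually_lt_of_limsup_lt h1 (isBoundedUnder_le_of_le_continuous hU h z)
  filter_upwards [eventually_eventually_nhds.2 h3] with y hy
  refine lt_of_le_of_lt (limsup_le_of_le (isCoboundedUnder_le_of_continuous_le hl hlu y) ?_) h2
  exact hy.mono fun _ hw => hw.le

theorem frequently_lt_of_lt_upperEnvelope (hl : Continuous l) (hlu : ∀ z, l z ≤ u z) {z : X}
    {c : ℝ} (hc : c < upperEnvelope u z) : ∃ᶠ y in 𝓝 z, c < u y :=
  frequently_lt_of_lt_limsup (isCoboundedUnder_le_of_continuous_le hl hlu z) hc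

end Envelope

theorem hjOp_eq_of_isLocalExtr {d : ℕ} (H : Eucl d → Eucl d → ℝ → ℝ) {φ ψ : Eucl d × ℝ → ℝ}
    (hφ : ContDiff ℝ 1 φ) (hψ : ContDiff ℝ 1 ψ) {z : Eucl d × ℝ}
    (h : IsLocalExtr (fun z => φ z - ψ z) z) : hjOp H φ z = hjOp H ψ z := by
  have h1 : fderiv ℝ φ z = fderiv ℝ ψ z := by
    have h2 := h.fderiv_eq_zero
    rw [fderiv_fun_sub (hφ.differentiable one_ne_zero z) (hψ.differentiable one_ne_zero z)] at h2
    exact sub_eq_zero.1 h2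
  rw [hjOp_eq_fderiv H hφ, hjOp_eq_fderiv H hψ, h1]

/-- The competitors in Perron's method: semicontinuous subsolutions between two barriers. -/
structure IsPerronCompetitor {d : ℕ} (H : Eucl d → Eucl d → ℝ → ℝ) (l U w : Eucl d × ℝ → ℝ) :
    Prop where
  usc : UpperSemicontinuous w
  lower_le : ∀ z, l z ≤ w z
  le_upper : ∀ z, w z ≤ U z
  sub : IsViscositySubsolution H w

/-- There is a greatest competitor: the upper semicontinuous envelope of the supremum of all
competitors is again a competitor. -/
theorem exists_greatest_competitor {d : ℕ} {H : Eucl d → Eucl d → ℝ → ℝ}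
    (hH : Continuous fun q : Eucl d × Eucl d × ℝ => H q.1 q.2.1 q.2.2)
    {l U : Eucl d × ℝ → ℝ} (hl : Continuous l) (hU : Continuous U)
    (hlc : IsPerronCompetitor H l U l) :
    ∃ u, IsPerronCompetitor H l U u ∧ ∀ w, IsPerronCompetitor H l U w → ∀ z, w z ≤ u z := by
  set s : Eucl d × ℝ → ℝ := fun z => sSup {r | ∃ w, IsPerronCompetitor H l U w ∧ r = w z} with hs
  have hbdd : ∀ z, BddAbove {r | ∃ w, IsPerronCompetitor H l U w ∧ r = w z} := by
    rintro z
    refine ⟨U z, ?_⟩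
    rintro r ⟨w, hw, rfl⟩
    exact hw.le_upper z
  have hle : ∀ w, IsPerronCompetitor H l U w → ∀ z, w z ≤ s z := fun w hw z =>
    le_csSup (hbdd z) ⟨w, hw, rfl⟩
  have hsU : ∀ z, s z ≤ U z := by
    intro z
    refine csSup_le ⟨_, l, hlc, rfl⟩ ?_
    rintro r ⟨w, hw, rfl⟩
    exact hw.le_upper z
  have hls : ∀ z, l z ≤ s z := hle l hlc
  refine ⟨upperEnvelope s, ⟨upperSemicontinuous_upperEnvelope hl hls hU hsU,
    fun z => (hls z).trans (le_upperEnvelope hU hsU z), upperEnvelope_le hl hls hU hsU, ?_⟩,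
    fun w hw z => (hle w hw z).trans (le_upperEnvelope hU hsU z)⟩
  intro φ hφ x t ht hmax
  change hjOp H φ (x, t) ≤ 0
  by_contra! hpos
  set z₀ : Eucl d × ℝ := (x, t) with hz₀
  set φ₂ : Eucl d × ℝ → ℝ := fun z => φ z + (1 * sqDist z₀ z + 0) with hφ₂
  have hφ₂c : ContDiff ℝ 1 φ₂ :=
    hφ.add ((contDiff_const.mul (contDiff_sqDist z₀)).add contDiff_const)
  have hop : 0 < hjOp H φ₂ z₀ := by rwa [hφ₂, hjOp_add_sqDist H hφ]
  have hev : ∀ᶠ z in 𝓝 z₀, 0 < hjOp H φ₂ z ∧ 0 < z.2 ∧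
      upperEnvelope s z - φ z ≤ upperEnvelope s z₀ - φ z₀ :=
    ((continuous_hjOp hH hφ₂c).continuousAt.eventually (lt_mem_nhds hop)).and
      (((continuous_snd.tendsto z₀).eventually (lt_mem_nhds ht)).and hmax)
  obtain ⟨r, hr0, hr⟩ := Metric.nhds_basis_closedBall.eventually_iff.1 hev
  set σ := r ^ 2 / 8 with hσ
  have hσ0 : 0 < σ := by positivity
  have hφ₂z : φ₂ z₀ = φ z₀ := by simp [hφ₂, sqDist_self]
  -- a competitor which is almost optimal at a point close to `z₀`
  obtain ⟨z₁, hz₁s, hz₁φ, hz₁r⟩ : ∃ z₁, upperEnvelope s z₀ - σ < s z₁ ∧ φ₂ z₁ < φ₂ z₀ + σ ∧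
      z₁ ∈ Metric.closedBall z₀ r := by
    have h1 := frequently_lt_of_lt_upperEnvelope hl hls (sub_lt_self (upperEnvelope s z₀) hσ0)
    have h2 : ∀ᶠ z in 𝓝 z₀, φ₂ z < φ₂ z₀ + σ ∧ z ∈ Metric.closedBall z₀ r :=
      (hφ₂c.continuous.continuousAt.eventually (gt_mem_nhds (lt_add_of_pos_right _ hσ0))).and
        (Metric.closedBall_mem_nhds z₀ hr0)
    obtain ⟨z, h3, h4, h5⟩ := (h1.and_eventually h2).exists
    exact ⟨z, h3, h4, h5⟩
  obtain ⟨w, hw, hwz⟩ : ∃ w, IsPerronCompetitor H l U w ∧ s z₁ - σ < w z₁ := by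
    obtain ⟨r', ⟨w, hw, rfl⟩, h2⟩ := exists_lt_of_lt_csSup
      (s := {r | ∃ w, IsPerronCompetitor H l U w ∧ r = w z₁}) ⟨_, l, hlc, rfl⟩
      (sub_lt_self (s z₁) hσ0)
    exact ⟨w, hw, h2⟩
  have husc : UpperSemicontinuous fun z => w z + -φ₂ z :=
    hw.usc.add hφ₂c.continuous.neg.upperSemicontinuous
  obtain ⟨z₂, hz₂, hmax₂⟩ := UpperSemicontinuousOn.exists_isMaxOn ⟨z₁, hz₁r⟩
    (isCompact_closedBall z₀ r) (husc.upperSemicontinuousOn _)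
  have h1 : w z₁ + -φ₂ z₁ ≤ w z₂ + -φ₂ z₂ := hmax₂ hz₁r
  have h2 : w z₂ ≤ upperEnvelope s z₂ := (hle w hw z₂).trans (le_upperEnvelope hU hsU z₂)
  obtain ⟨g1, g2, g3⟩ := hr hz₂
  have h3 : dist z₂ z₀ ^ 2 ≤ sqDist z₀ z₂ := sq_dist_le_sqDist z₀ z₂
  have h4 : φ₂ z₂ = φ z₂ + sqDist z₀ z₂ := by simp [hφ₂]
  have h5 : dist z₂ z₀ < r := by
    refine lt_of_pow_lt_pow_left₀ 2 hr0.le ?_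
    linarith
  have hloc : IsLocalMax (fun z => w z - φ₂ z) z₂ := by
    filter_upwards [Metric.isOpen_ball.mem_nhds (Metric.mem_ball.2 h5)] with z hz
    have : w z + -φ₂ z ≤ w z₂ + -φ₂ z₂ := hmax₂ (Metric.ball_subset_closedBall hz)
    linarith
  exact absurd (hw.sub.hjOp_nonpos hφ₂c g2 hloc) (not_le.2 g1)

/-- The bump construction: raising a competitor by a smooth strict subsolution in a small ball
produces a competitor. -/
theorem IsPerronCompetitor.bump {d : ℕ} {H : Eucl d → Eucl d → ℝ → ℝ}
    {l U u φ : Eucl d × ℝ → ℝ} (hu : IsPerronCompetitor H l U u) (hφ : ContDiff ℝ 1 φ)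
    {z₀ : Eucl d × ℝ} {r : ℝ} (hr : 0 < r)
    (hU : ∀ z, dist z z₀ < r → φ z ≤ U z)
    (hop : ∀ z, dist z z₀ < r → hjOp H φ z ≤ 0)
    (hout : ∀ z, r / 2 < dist z z₀ → dist z z₀ < r → φ z ≤ u z) :
    IsPerronCompetitor H l U fun z => if dist z z₀ < r then max (u z) (φ z) else u z := by
  set w : Eucl d × ℝ → ℝ := fun z => if dist z z₀ < r then max (u z) (φ z) else u z with hw
  have hin : ∀ z, dist z z₀ < r → w z = max (u z) (φ z) := fun z hz => if_pos hz
  have hfar : ∀ z, r / 2 < dist z z₀ → w z = u z := by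
    intro z hz
    by_cases h : dist z z₀ < r
    · rw [hin z h, max_eq_left (hout z hz h)]
    · exact if_neg h
  have hball : ∀ z, dist z z₀ < r → ∀ᶠ y in 𝓝 z, dist y z₀ < r := fun z hz =>
    Metric.isOpen_ball.mem_nhds hz
  have hevfar : ∀ z, ¬dist z z₀ < r → ∀ᶠ y in 𝓝 z, w y = u y := by
    intro z hz
    have h1 : r / 2 < dist z z₀ := by linarith
    have h2 : ∀ᶠ y in 𝓝 z, r / 2 < dist y z₀ :=
      (continuous_id.dist continuous_const).continuousAt.eventually (lt_mem_nhds h1)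
    exact h2.mono hfar
  have huw : ∀ z, u z ≤ w z := by
    intro z
    by_cases h : dist z z₀ < r
    · rw [hin z h]; exact le_max_left _ _
    · rw [(hevfar z h).self_of_nhds]
  refine ⟨?_, fun z => (hu.lower_le z).trans (huw z), ?_, ?_⟩
  · intro z c hc
    by_cases h : dist z z₀ < r
    · rw [hin z h, max_lt_iff] at hc
      filter_upwards [hball z h, hu.usc z c hc.1,
        hφ.continuous.continuousAt.eventually (gt_mem_nhds hc.2)] with y h1 h2 h3
      rw [hin y h1]
      exact max_lt h2 h3
    · rw [(hevfar z h).self_of_nhds] at hc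
      filter_upwards [hevfar z h, hu.usc z c hc] with y h1 h2
      rwa [h1]
  · intro z
    by_cases h : dist z z₀ < r
    · rw [hin z h]; exact max_le (hu.le_upper z) (hU z h)
    · rw [(hevfar z h).self_of_nhds]; exact hu.le_upper z
  · intro ψ hψ x t ht hmax
    change hjOp H ψ (x, t) ≤ 0
    by_cases heq : w (x, t) = u (x, t)
    · refine hu.sub.hjOp_nonpos hψ ht ?_
      filter_upwards [hmax] with y hy
      have := huw y
      rw [heq] at hy
      linarith
    · have h : dist (x, t) z₀ < r := by
        by_contra h
        exact heq (hevfar _ h).self_of_nhds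
      have h2 : w (x, t) = φ (x, t) := by
        rw [hin _ h] at heq ⊢
        rcases max_choice (u (x, t)) (φ (x, t)) with h3 | h3
        · exact absurd h3 heq
        · exact h3
      rw [← hjOp_eq_of_isLocalExtr H hφ hψ (z := (x, t)) (Or.inr ?_)]
      · exact hop _ h
      · filter_upwards [hmax, hball _ h] with y hy hy'
        have : φ y ≤ w y := by rw [hin y hy']; exact le_max_right _ _
        rw [h2] at hy
        linarith

/-- The lower semicontinuous envelope of the greatest competitor is a supersolution, since
otherwise the greatest competitor could be raised. -/
theorem isViscositySupersolution_of_greatest {d : ℕ} {H : Eucl d → Eucl d → ℝ → ℝ}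
    (hH : Continuous fun q : Eucl d × Eucl d × ℝ => H q.1 q.2.1 q.2.2)
    {l U u : Eucl d × ℝ → ℝ} (hl : Continuous l) (hU : Continuous U)
    (hUsuper : IsViscositySupersolution H U) (hu : IsPerronCompetitor H l U u)
    (hgreatest : ∀ w, IsPerronCompetitor H l U w → ∀ z, w z ≤ u z) :
    IsViscositySupersolution H fun z => -upperEnvelope (fun y => -u y) z := by
  set v : Eucl d × ℝ → ℝ := fun z => -upperEnvelope (fun y => -u y) z with hv
  have hnl : ∀ z, -U z ≤ -u z := fun z => neg_le_neg (hu.le_upper z)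
  have hnU : ∀ z, -u z ≤ -l z := fun z => neg_le_neg (hu.lower_le z)
  have hvu : ∀ z, v z ≤ u z := fun z => neg_le.1 (le_upperEnvelope hl.neg hnU z)
  intro φ hφ x t ht hmin
  change 0 ≤ hjOp H φ (x, t)
  by_contra! hneg
  set z₀ : Eucl d × ℝ := (x, t) with hz₀
  have hmin' : ∀ᶠ z in 𝓝 z₀, v z₀ - φ z₀ ≤ v z - φ z := hmin
  have hlt : v z₀ < U z₀ := by
    refine lt_of_le_of_ne ((hvu z₀).trans (hu.le_upper z₀)) fun heq => ?_
    refine absurd (hUsuper.hjOp_nonneg hφ (z := z₀) ht ?_) (not_le.2 hneg)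
    filter_upwards [hmin'] with z hz
    have h1 := (hvu z).trans (hu.le_upper z)
    rw [heq] at hz
    linarith
  set φ₂ : Eucl d × ℝ → ℝ := fun z => φ z + (-1 * sqDist z₀ z + (v z₀ - φ z₀)) with hφ₂
  have hφ₂c : ContDiff ℝ 1 φ₂ :=
    hφ.add ((contDiff_const.mul (contDiff_sqDist z₀)).add contDiff_const)
  have hφ₂z : φ₂ z₀ = v z₀ := by simp [hφ₂, sqDist_self]
  have hop : hjOp H φ₂ z₀ < 0 := by rwa [hφ₂, hjOp_add_sqDist H hφ]
  set κ := (U z₀ - v z₀) / 2 with hκ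
  have hκ0 : 0 < κ := by rw [hκ]; linarith
  have hev : ∀ᶠ z in 𝓝 z₀, hjOp H φ₂ z < 0 ∧ φ₂ z + κ < U z ∧ v z₀ - φ z₀ ≤ v z - φ z := by
    refine ((continuous_hjOp hH hφ₂c).continuousAt.eventually (gt_mem_nhds hop)).and
      (Eventually.and ?_ hmin')
    refine ContinuousAt.eventually_lt (hφ₂c.continuous.add continuous_const).continuousAt
      hU.continuousAt ?_
    rw [hφ₂z, hκ]; linarith
  obtain ⟨r, hr0, hr⟩ := Metric.nhds_basis_ball.eventually_iff.1 hev
  set δ := min κ (r ^ 2 / 8) with hδ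
  have hδ0 : 0 < δ := by positivity
  have hδκ : δ ≤ κ := min_le_left _ _
  have hδr : δ ≤ r ^ 2 / 8 := min_le_right _ _
  have hψ : ContDiff ℝ 1 fun z => φ₂ z + δ := hφ₂c.add contDiff_const
  have hbump := hu.bump (φ := fun z => φ₂ z + δ) (z₀ := z₀) (r := r) hψ hr0
    (fun z hz => by
      have := (hr hz).2.1
      linarith)
    (fun z hz => by
      have h1 := hjOp_eq_of_isLocalExtr H hψ hφ₂c (z := z)
        (Or.inl (by filter_upwards with y; linarith))
      rw [h1]
      exact (hr hz).1.le)
    (fun z hz hz' => by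
      have h1 := (hr hz').2.2
      have h2 := sq_dist_le_sqDist z₀ z
      have h3 : (r / 2) ^ 2 < dist z z₀ ^ 2 := by gcongr
      have h4 := hvu z
      simp only [hφ₂]
      linarith)
  -- the bump is strictly larger somewhere close to `z₀`
  have h1 : -v z₀ - δ / 2 < upperEnvelope (fun y => -u y) z₀ := by
    simp only [hv]; linarith
  have h2 : ∀ᶠ z in 𝓝 z₀, v z₀ - δ / 2 < φ₂ z ∧ z ∈ Metric.ball z₀ r :=
    (hφ₂c.continuous.continuousAt.eventually (lt_mem_nhds (by linarith))).and
      (Metric.ball_mem_nhds z₀ hr0)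
  obtain ⟨z, h3, h4, h5⟩ :=
    ((frequently_lt_of_lt_upperEnvelope hU.neg hnl h1).and_eventually h2).exists
  have h6 := hgreatest _ hbump z
  rw [if_pos (Metric.mem_ball.1 h5)] at h6
  have h7 := (le_max_right _ _).trans h6
  linarith

/-! ### Well-posedness of the initial value problem -/

/-- A continuous function agreeing for positive times with a `C¹` classical subsolution is a
viscosity subsolution. -/
theorem isViscositySubsolution_of_smooth {d : ℕ} {H : Eucl d → Eucl d → ℝ → ℝ}
    {u S : Eucl d × ℝ → ℝ} (hS : ContDiff ℝ 1 S) (huS : ∀ z, 0 < z.2 → u z = S z)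
    (hop : ∀ z, 0 < z.2 → hjOp H S z ≤ 0) : IsViscositySubsolution H u := by
  intro φ hφ x t ht hmax
  change hjOp H φ (x, t) ≤ 0
  rw [← hjOp_eq_of_isLocalExtr H hS hφ (z := (x, t)) (Or.inr ?_)]
  · exact hop (x, t) ht
  · have : ∀ᶠ z : Eucl d × ℝ in 𝓝 (x, t), 0 < z.2 :=
      (continuous_snd.tendsto (x, t)).eventually (lt_mem_nhds ht)
    filter_upwards [hmax, this] with z hz hz'
    rwa [huS z hz', huS (x, t) ht] at hz

theorem isViscositySupersolution_of_smooth {d : ℕ} {H : Eucl d → Eucl d → ℝ → ℝ}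
    {u S : Eucl d × ℝ → ℝ} (hS : ContDiff ℝ 1 S) (huS : ∀ z, 0 < z.2 → u z = S z)
    (hop : ∀ z, 0 < z.2 → 0 ≤ hjOp H S z) : IsViscositySupersolution H u := by
  intro φ hφ x t ht hmin
  change 0 ≤ hjOp H φ (x, t)
  rw [← hjOp_eq_of_isLocalExtr H hS hφ (z := (x, t)) (Or.inl ?_)]
  · exact hop (x, t) ht
  · have : ∀ᶠ z : Eucl d × ℝ in 𝓝 (x, t), 0 < z.2 :=
      (continuous_snd.tendsto (x, t)).eventually (lt_mem_nhds ht)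
    filter_upwards [hmin, this] with z hz hz'
    rwa [huS z hz', huS (x, t) ht] at hz

/-- The linear barriers `ξ₀ · x + M t`. -/
theorem hjOp_linear {d : ℕ} (h : Eucl d → ℝ) (V : Eucl d → ℝ → ℝ) (ξ₀ : Eucl d) (M : ℝ)
    (z : Eucl d × ℝ) : hjOp (fun ξ x t => h ξ - V x t) (fun z => inner ℝ ξ₀ z.1 + M * z.2) z =
      M + (h ξ₀ - V z.1 z.2) := by
  refine hjOp_eq _ (x := z.1) (t := z.2) ?_ ?_
  · exact (((hasDerivAt_id z.2).const_mul M).const_add (inner ℝ ξ₀ z.1)).congr_deriv (mul_one M)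
  · have := (hasGradientAt_inner ξ₀ z.1).add' (hasGradientAt_const' (M * z.2) z.1)
    rwa [add_zero] at this

/-- The rate `M` of the a-priori bounds, valid for `h` as well as for its dual. -/
theorem exists_speed_bound {d : ℕ} {h : Eucl d → ℝ} (hh : Continuous h) (ξ₀ : Eucl d) (B : ℝ) :
    ∃ M, 0 ≤ M ∧ ∀ q : Eucl d, ‖q‖ ≤ 1 → |h (ξ₀ + q)| + B ≤ M := by
  obtain ⟨C, hC⟩ := (isCompact_closedBall (0 : Eucl d) 1).exists_bound_of_continuousOn
    (f := fun q => h (ξ₀ + q)) (by fun_prop)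
  refine ⟨|C| + |B|, by positivity, fun q hq => ?_⟩
  have := hC q (by simpa using hq)
  rw [Real.norm_eq_abs] at this
  linarith [le_abs_self C, le_abs_self B]

/-- The solutions of the initial value problem may be modified for negative times so as to become
continuous on the whole space. -/
theorem IsViscositySolution.exists_continuous {d : ℕ} {H : Eucl d → Eucl d → ℝ → ℝ} {ξ₀ : Eucl d}
    {u : Eucl d × ℝ → ℝ} (hu : IsViscositySolution H ξ₀ u) :
    ∃ w : Eucl d × ℝ → ℝ, Continuous w ∧ (∀ x t, 0 ≤ t → w (x, t) = u (x, t)) ∧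
      IsViscositySolution H ξ₀ w := by
  set w : Eucl d × ℝ → ℝ := fun z => u (z.1, max z.2 0) with hw
  have hwc : Continuous w :=
    hu.continuousOn.comp_continuous (by fun_prop) fun z => le_max_right z.2 0
  have hwu : ∀ x t, 0 ≤ t → w (x, t) = u (x, t) := fun x t ht => by simp [hw, max_eq_left ht]
  have hev : ∀ (x : Eucl d) (t : ℝ), 0 < t → ∀ᶠ z : Eucl d × ℝ in 𝓝 (x, t), w z = u z := by
    intro x t ht
    filter_upwards [(continuous_snd.tendsto (x, t)).eventually (lt_mem_nhds ht)] with z hz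
    exact hwu z.1 z.2 (le_of_lt hz)
  refine ⟨w, hwc, hwu, hwc.continuousOn, fun x => (hwu x 0 le_rfl).trans (hu.initial x),
    fun T => ?_, ?_, ?_⟩
  · obtain ⟨C, hC⟩ := hu.bounded T
    exact ⟨C, fun x t h0 hT => by rw [hwu x t h0]; exact hC x t h0 hT⟩
  · intro φ hφ x t ht hmax
    refine hu.sub φ hφ x t ht ?_
    filter_upwards [hmax, hev x t ht] with z hz hz'
    rwa [hz', hwu x t ht.le] at hz
  · intro φ hφ x t ht hmin
    refine hu.super φ hφ x t ht ?_
    filter_upwards [hmin, hev x t ht] with z hz hz'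
    rwa [hz', hwu x t ht.le] at hz

/-- A solution is at most linearly, with an explicit rate, above its initial datum. -/
theorem IsViscositySolution.le_linear {d : ℕ} {h : Eucl d → ℝ} {V : Eucl d → ℝ → ℝ} {B : ℝ}
    (hB : ∀ x t, |V x t| ≤ B) {ξ₀ : Eucl d} {M : ℝ}
    (hM : ∀ q : Eucl d, ‖q‖ ≤ 1 → |h (ξ₀ + q)| + B ≤ M) {u : Eucl d × ℝ → ℝ} (hc : Continuous u)
    (hu : IsViscositySolution (fun ξ x t => h ξ - V x t) ξ₀ u) (x : Eucl d) (t : ℝ) (ht : 0 ≤ t) :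
    u (x, t) ≤ inner ℝ ξ₀ x + M * t := by
  refine hu.sub.le_linear (fun q x t hq => ?_) hc.upperSemicontinuous
    (fun x => (hu.initial x).le) (fun T => ?_) x t ht
  · have h1 := hM q hq
    have h2 := abs_le.1 (hB x t)
    linarith [neg_abs_le (h (ξ₀ + q))]
  · obtain ⟨C, hC⟩ := hu.bounded T
    exact ⟨C, fun x t h0 hT => by linarith [(abs_le.1 (hC x t h0 hT)).2]⟩

/-- The negative of a solution solves the dual problem. -/
theorem IsViscositySolution.neg {d : ℕ} {h : Eucl d → ℝ} {V : Eucl d → ℝ → ℝ} {ξ₀ : Eucl d}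
    {u : Eucl d × ℝ → ℝ} (hu : IsViscositySolution (fun ξ x t => h ξ - V x t) ξ₀ u) :
    IsViscositySolution (fun ξ x t => -h (-ξ) - -V x t) (-ξ₀) fun z => -u z := by
  have e : (fun ξ x t => -h (-ξ) - -V x t) = dualHamiltonian fun ξ x t => h ξ - V x t := by
    funext ξ x t; simp only [dualHamiltonian]; ring
  refine ⟨hu.continuousOn.neg, fun x => by rw [hu.initial, inner_neg_left], fun T => ?_,
    e ▸ hu.super.neg, e ▸ hu.sub.neg⟩
  obtain ⟨C, hC⟩ := hu.bounded T
  refine ⟨C, fun x t h0 hT => ?_⟩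
  rw [inner_neg_left, ← abs_neg]
  convert hC x t h0 hT using 2
  ring

theorem IsViscositySolution.linear_le {d : ℕ} {h : Eucl d → ℝ} {V : Eucl d → ℝ → ℝ} {B : ℝ}
    (hB : ∀ x t, |V x t| ≤ B) {ξ₀ : Eucl d} {M : ℝ}
    (hM : ∀ q : Eucl d, ‖q‖ ≤ 1 → |h (ξ₀ + q)| + B ≤ M) {u : Eucl d × ℝ → ℝ} (hc : Continuous u)
    (hu : IsViscositySolution (fun ξ x t => h ξ - V x t) ξ₀ u) (x : Eucl d) (t : ℝ) (ht : 0 ≤ t) :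
    inner ℝ ξ₀ x - M * t ≤ u (x, t) := by
  have := hu.neg.le_linear (B := B) (M := M) (fun x t => by rw [abs_neg]; exact hB x t)
    (fun q hq => by
      rw [abs_neg, neg_add, neg_neg]
      exact hM (-q) (by rwa [norm_neg])) hc.neg x t ht
  rw [inner_neg_left] at this
  change -u (x, t) ≤ _ at this
  linarith

/-- Uniqueness for the initial value problem. -/
theorem IsViscositySolution.unique {d : ℕ} {h : Eucl d → ℝ} (hh : Continuous h)
    {V : Eucl d → ℝ → ℝ} {L B : ℝ} (hL : 0 ≤ L)
    (hV : ∀ x y t s, |V x t - V y s| ≤ L * (‖x - y‖ + |t - s|)) (hB : ∀ x t, |V x t| ≤ B)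
    {ξ₀ : Eucl d} {u v : Eucl d × ℝ → ℝ}
    (hu : IsViscositySolution (fun ξ x t => h ξ - V x t) ξ₀ u)
    (hv : IsViscositySolution (fun ξ x t => h ξ - V x t) ξ₀ v) (x : Eucl d) (t : ℝ) (ht : 0 ≤ t) :
    u (x, t) = v (x, t) := by
  obtain ⟨u', huc, huu, hu'⟩ := hu.exists_continuous
  obtain ⟨v', hvc, hvv, hv'⟩ := hv.exists_continuous
  obtain ⟨M, hM0, hM⟩ := exists_speed_bound hh ξ₀ B
  rw [← huu x t ht, ← hvv x t ht]
  refine le_antisymm ?_ ?_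
  · exact comparison hh hL hV huc.upperSemicontinuous hvc.lowerSemicontinuous hu'.sub hv'.super hM0
      (hu'.le_linear hB hM huc) (hv'.linear_le hB hM hvc) x t ht
  · exact comparison hh hL hV hvc.upperSemicontinuous huc.lowerSemicontinuous hv'.sub hu'.super hM0
      (hv'.le_linear hB hM hvc) (hu'.linear_le hB hM huc) x t ht

/-- Existence for the initial value problem, by Perron's method. -/
theorem exists_isViscositySolution {d : ℕ} {h : Eucl d → ℝ} (hh : Continuous h)
    {V : Eucl d → ℝ → ℝ} {L B : ℝ} (hL : 0 ≤ L)
    (hV : ∀ x y t s, |V x t - V y s| ≤ L * (‖x - y‖ + |t - s|)) (hB : ∀ x t, |V x t| ≤ B)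
    (ξ₀ : Eucl d) :
    ∃ u, IsViscositySolution (fun ξ x t => h ξ - V x t) ξ₀ u := by
  obtain ⟨M, hM0, hM⟩ := exists_speed_bound hh ξ₀ B
  have hMh : |h ξ₀| + B ≤ M := by simpa using hM 0 (by simp)
  have hVc : Continuous fun z : Eucl d × ℝ => V z.1 z.2 := by
    have : LipschitzWith (L * 2).toNNReal fun z : Eucl d × ℝ => V z.1 z.2 := by
      refine LipschitzWith.of_dist_le_mul fun z w => ?_
      rw [Real.coe_toNNReal _ (by positivity), Real.dist_eq, Prod.dist_eq, dist_eq_norm,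
        Real.dist_eq]
      refine (hV _ _ _ _).trans ?_
      rw [mul_assoc]
      gcongr
      linarith [le_max_left ‖z.1 - w.1‖ |z.2 - w.2|, le_max_right ‖z.1 - w.1‖ |z.2 - w.2|]
    exact this.continuous
  set H : Eucl d → Eucl d → ℝ → ℝ := fun ξ x t => h ξ - V x t with hHdef
  have hH : Continuous fun q : Eucl d × Eucl d × ℝ => H q.1 q.2.1 q.2.2 :=
    (hh.comp continuous_fst).sub (hVc.comp continuous_snd)
  set l : Eucl d × ℝ → ℝ := fun z => inner ℝ ξ₀ z.1 + -(M * |z.2|) with hl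
  set U : Eucl d × ℝ → ℝ := fun z => inner ℝ ξ₀ z.1 + M * |z.2| with hU
  have hlc : Continuous l := by fun_prop
  have hUc : Continuous U := by fun_prop
  have hlin : ∀ m : ℝ, ContDiff ℝ 1 fun z : Eucl d × ℝ => inner ℝ ξ₀ z.1 + m * z.2 := fun m =>
    (contDiff_const.inner ℝ contDiff_fst).add (contDiff_const.mul contDiff_snd)
  have hlsub : IsViscositySubsolution H l := by
    refine isViscositySubsolution_of_smooth (hlin (-M)) (fun z hz => ?_) fun z hz => ?_
    · simp [hl, abs_of_pos hz]
    · rw [hHdef, hjOp_linear]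
      have := abs_le.1 (hB z.1 z.2)
      linarith [le_abs_self (h ξ₀)]
  have hUsuper : IsViscositySupersolution H U := by
    refine isViscositySupersolution_of_smooth (hlin M) (fun z hz => ?_) fun z hz => ?_
    · simp [hU, abs_of_pos hz]
    · rw [hHdef, hjOp_linear]
      have := abs_le.1 (hB z.1 z.2)
      linarith [neg_abs_le (h ξ₀)]
  have hlU : ∀ z, l z ≤ U z := fun z => by
    have : 0 ≤ M * |z.2| := by positivity
    simp only [hl, hU]; linarith
  obtain ⟨u, hu, hgreatest⟩ := exists_greatest_competitor hH hlc hUc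
    ⟨hlc.upperSemicontinuous, fun _ => le_rfl, hlU, hlsub⟩
  have hsuper := isViscositySupersolution_of_greatest hH hlc hUc hUsuper hu hgreatest
  set v : Eucl d × ℝ → ℝ := fun z => -upperEnvelope (fun y => -u y) z with hv
  have hnl : ∀ z, -U z ≤ -u z := fun z => neg_le_neg (hu.le_upper z)
  have hnU : ∀ z, -u z ≤ -l z := fun z => neg_le_neg (hu.lower_le z)
  have hvu : ∀ z, v z ≤ u z := fun z => neg_le.1 (le_upperEnvelope hlc.neg hnU z)
  have hlv : ∀ z, l z ≤ v z := fun z =>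
    le_neg.1 (upperEnvelope_le hUc.neg hnl hlc.neg hnU z)
  have hvlsc : LowerSemicontinuous v :=
    (upperSemicontinuous_upperEnvelope hUc.neg hnl hlc.neg hnU).neg
  have huv : ∀ x t, 0 ≤ t → u (x, t) ≤ v (x, t) := by
    refine comparison hh hL hV hu.usc hvlsc hu.sub hsuper hM0 (ξ₀ := ξ₀) (fun x t ht => ?_)
      fun x t ht => ?_
    · simpa [hU, abs_of_nonneg ht] using hu.le_upper (x, t)
    · simpa [hl, abs_of_nonneg ht, sub_eq_add_neg] using hlv (x, t)
  have huv' : ∀ x t, 0 ≤ t → u (x, t) = v (x, t) := fun x t ht =>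
    le_antisymm (huv x t ht) (hvu _)
  refine ⟨u, ?_, fun x => ?_, fun T => ⟨M * T, fun x t h0 hT => ?_⟩, hu.sub, ?_⟩
  · rintro ⟨x, t⟩ ht
    refine ContinuousAt.continuousWithinAt ?_
    refine continuousAt_iff_lower_upperSemicontinuousAt.2 ⟨fun c hc => ?_, hu.usc (x, t)⟩
    change c < u (x, t) at hc
    rw [huv' x t ht] at hc
    filter_upwards [hvlsc (x, t) c hc] with y hy
    exact lt_of_lt_of_le hy (hvu y)
  · have h1 := hu.lower_le (x, 0)
    have h2 := hu.le_upper (x, 0)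
    simp only [hl, hU, abs_zero, mul_zero, neg_zero, add_zero] at h1 h2
    exact le_antisymm h2 h1
  · have h1 := hu.lower_le (x, t)
    have h2 := hu.le_upper (x, t)
    simp only [hl, hU, abs_of_nonneg h0] at h1 h2
    have : M * t ≤ M * T := by gcongr
    rw [abs_le]
    constructor <;> linarith
  · intro φ hφ x t ht hmin
    refine hsuper φ hφ x t ht ?_
    have : ∀ᶠ z : Eucl d × ℝ in 𝓝 (x, t), 0 < z.2 :=
      (continuous_snd.tendsto (x, t)).eventually (lt_mem_nhds ht)
    filter_upwards [hmin, this] with z hz hz'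
    rwa [huv' x t ht.le, huv' z.1 z.2 (le_of_lt hz')] at hz

/-! ### The barrier attached to a slab -/

theorem hasDerivAt_sqrt_sq_add_sq {ε : ℝ} (hε : 0 < ε) (k a s : ℝ) {f : ℝ → ℝ} {f' : ℝ}
    (hf : HasDerivAt f f' s) (ha : f s = a) :
    HasDerivAt (fun s => k * √(ε ^ 2 + f s ^ 2)) (k * a / √(ε ^ 2 + a ^ 2) * f') s := by
  subst ha
  have h1 := (((hf.pow 2).const_add (ε ^ 2)).sqrt
    (show ε ^ 2 + f s ^ 2 ≠ 0 by positivity)).const_mul k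
  refine h1.congr_deriv ?_
  simp only [Pi.pow_apply]
  field_simp
  ring

/-- The slope `p` of the barrier is at most `k`, and at least `k / √2` away from the bar. -/
theorem barrier_slope {ε k a : ℝ} (hε : 0 < ε) (hk : 0 ≤ k) :
    |k * a / √(ε ^ 2 + a ^ 2)| ≤ k ∧
      (ε ≤ |a| → k ^ 2 / 2 ≤ (k * a / √(ε ^ 2 + a ^ 2)) ^ 2) := by
  have hpos : 0 < ε ^ 2 + a ^ 2 := by positivity
  have hs : 0 < √(ε ^ 2 + a ^ 2) := Real.sqrt_pos.2 hpos
  constructor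
  · rw [abs_div, abs_mul, abs_of_nonneg hk, abs_of_pos hs, div_le_iff₀ hs]
    refine mul_le_mul_of_nonneg_left (Real.abs_le_sqrt ?_) hk
    nlinarith
  · intro ha
    have h1 : ε ^ 2 ≤ a ^ 2 := by rw [← sq_abs a]; gcongr
    rw [div_pow, Real.sq_sqrt hpos.le, div_le_div_iff₀ (by norm_num) hpos]
    nlinarith [mul_le_mul_of_nonneg_left h1 (sq_nonneg k)]

/-- If `h` lies above the parabola `h ξ₀ + p β + A p²` on the line through `ξ₀` with direction `e`,
then a solution descends at a definite extra rate, up to the time `t₀`, in every potential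
`|V| ≤ η` that equals `-η` in a thin slab `|⟨e, x⟩ - β t - y₀| ≤ ε` passing close to `(0, t₀)`:
the minimizing player goes to the slab and stays in it. -/
theorem solution_le_of_slab {d : ℕ} {h : Eucl d → ℝ} (hh : Continuous h) (ξ₀ e : Eucl d)
    {β A k η t₀ : ℝ} (hk : 0 < k) (hη : 0 < η) (hηA : 4 * η ≤ A * k ^ 2) (ht₀ : 0 < t₀)
    (htaylor : ∀ p : ℝ, |p| ≤ k → h ξ₀ + p * β + A * p ^ 2 ≤ h (ξ₀ + p • e)) :
    ∃ R T : ℝ, ∀ (V : Eucl d → ℝ → ℝ) (u : Eucl d × ℝ → ℝ), (∀ x t, |V x t| ≤ η) →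
      IsViscositySolution (fun ξ x t => h ξ - V x t) ξ₀ u → ∀ ε y₀ : ℝ, 0 < ε →
      (∀ x t, ‖x‖ ≤ R → 0 < t → t < T → |inner ℝ e x - β * t - y₀| ≤ ε → V x t ≤ -η) →
      u (0, t₀) ≤ -h ξ₀ * t₀ - η / 4 * t₀ + k * (ε + |β * t₀ + y₀|) := by
  have hA : 0 < A := by
    by_contra! hA
    nlinarith [mul_nonneg (neg_nonneg.2 hA) (sq_nonneg k)]
  obtain ⟨M, hM0, hM⟩ := exists_speed_bound hh ξ₀ η
  -- the weight of the penalization at infinity perturbs the Hamiltonian by less than `η / 2`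
  obtain ⟨κ, hκ0, hκ⟩ := exists_pos_abs_sub_lt hh (‖ξ₀‖ + k * ‖e‖) (half_pos hη)
  set N := M + |h ξ₀| + η / 2 with hN
  have hN0 : 0 < N := by positivity
  set T := 4 * t₀ * N / η + t₀ with hT
  have hT0 : t₀ ≤ T := by rw [hT]; linarith [show 0 < 4 * t₀ * N / η by positivity]
  have hTN : 4 * t₀ * N ≤ η * T := by
    have h1 : η * T = 4 * t₀ * N + η * t₀ := by rw [hT]; field_simp
    linarith [mul_pos hη ht₀]
  set R := N * T / κ + 1 with hR
  refine ⟨R, T, fun V u hV hu ε y₀ hε hslab => ?_⟩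
  obtain ⟨w, hwc, hwu, hw⟩ := hu.exists_continuous
  rw [← hwu 0 t₀ ht₀.le]
  -- along the slab coordinate the slope saturates at `k`; the quadratic term in time makes the
  -- region of contact bounded in time, while its derivative stays above the rate `-η / 2`
  set S : Eucl d × ℝ → ℝ := fun z => inner ℝ ξ₀ z.1 + (-h ξ₀ * z.2 +
    η / 2 * (z.2 ^ 2 / (2 * t₀) - z.2)) + k * √(ε ^ 2 + (inner ℝ e z.1 - β * z.2 - y₀) ^ 2) +
    κ * softDist 0 z.1 with hS
  have hSc : ContDiff ℝ 1 S := by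
    have h1 : ∀ a : Eucl d, ContDiff ℝ 1 fun z : Eucl d × ℝ => (inner ℝ a z.1 : ℝ) := fun a =>
      contDiff_const.inner ℝ contDiff_fst
    refine ContDiff.add (ContDiff.add (ContDiff.add (h1 ξ₀) (by fun_prop)) ?_) ?_
    · refine contDiff_const.mul (ContDiff.sqrt ?_ fun z => by positivity)
      exact contDiff_const.add ((((h1 e).sub (contDiff_const.mul contDiff_snd)).sub
        contDiff_const).pow 2)
    · exact contDiff_const.mul ((contDiff_softDist 0).comp contDiff_fst)
  -- the barrier can only be touched in a bounded region, which does not depend on `ε`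
  have region : ∀ x t, 0 ≤ t → S (x, t) < w (x, t) →
      η * t ^ 2 / (4 * t₀) + κ * softDist 0 x < N * t := by
    intro x t ht hlt
    have h1 := hw.le_linear hV hM hwc x t ht
    have h2 : 0 ≤ k * √(ε ^ 2 + (inner ℝ e x - β * t - y₀) ^ 2) := by positivity
    have h3 : h ξ₀ * t ≤ |h ξ₀| * t := by gcongr; exact le_abs_self _
    have h4 : η / 2 * (t ^ 2 / (2 * t₀) - t) = η * t ^ 2 / (4 * t₀) - η / 2 * t := by
      field_simp; ring
    simp only [hS] at hlt
    rw [h4] at hlt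
    rw [hN]
    linarith
  have hfar : ∀ x t, 0 ≤ t → t ≤ T → S (x, t) < w (x, t) → ‖x‖ ≤ R := by
    intro x t ht htT hlt
    have h1 := region x t ht hlt
    have h2 := norm_sub_le_softDist 0 x
    rw [sub_zero] at h2
    have h3 : 0 ≤ η * t ^ 2 / (4 * t₀) := by positivity
    have h4 : N * t ≤ N * T := by gcongr
    have h5 : softDist 0 x ≤ N * T / κ := by rw [le_div_iff₀ hκ0]; linarith
    rw [hR]
    linarith
  have key : w (0, t₀) ≤ S (0, t₀) := by
    refine hw.sub.le_of_strict (T := T) (R := R) hwc.upperSemicontinuous hSc ?_ ?_ ?_ ?_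
      0 t₀ ht₀.le hT0
    · intro x
      have h1 := softDist_nonneg 0 x
      have h2 : 0 ≤ k * √(ε ^ 2 + (inner ℝ e x - β * 0 - y₀) ^ 2) := by positivity
      have h3 := mul_nonneg hκ0.le h1
      rw [hw.initial]
      simp only [hS]
      rw [show η / 2 * ((0 : ℝ) ^ 2 / (2 * t₀) - 0) = 0 by simp]
      linarith
    · intro x
      by_contra! hlt
      have hTpos : 0 < T := by linarith
      have h1 := region x T hTpos.le hlt
      have h2 := mul_nonneg hκ0.le (softDist_nonneg 0 x)
      have h3 : N * T ≤ η * T ^ 2 / (4 * t₀) := by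
        rw [le_div_iff₀ (by positivity)]
        nlinarith [mul_le_mul_of_nonneg_right hTN hTpos.le]
      linarith
    · intro x t ht htT hx
      by_contra! hlt
      exact absurd (hfar x t ht htT hlt) (not_le.2 hx)
    · intro x t ht htT hlt
      obtain ⟨q, hq, hq'⟩ := exists_hasGradientAt_softDist 0 x
      set a := inner ℝ e x - β * t - y₀ with ha
      set p := k * a / √(ε ^ 2 + a ^ 2) with hp
      have hder : HasDerivAt (fun s => S (x, s))
          (-h ξ₀ + η / 2 * (t / t₀ - 1) + p * -β) t := by
        have h1 : HasDerivAt (fun s : ℝ => -h ξ₀ * s + η / 2 * (s ^ 2 / (2 * t₀) - s))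
            (-h ξ₀ + η / 2 * (t / t₀ - 1)) t := by
          have h2 := ((hasDerivAt_id t).const_mul (-h ξ₀)).add
            (((((hasDerivAt_id t).pow 2).div_const (2 * t₀)).sub (hasDerivAt_id t)).const_mul
              (η / 2))
          refine h2.congr_deriv ?_
          simp only [id, mul_one]
          field_simp
          ring
        have h2 : HasDerivAt (fun s => inner ℝ e x - β * s - y₀) (-β) t :=
          ((((hasDerivAt_id t).const_mul β).const_sub _).sub_const _).congr_deriv (by simp)
        exact ((h1.const_add (inner ℝ ξ₀ x)).add
          (hasDerivAt_sqrt_sq_add_sq hε k a t h2 ha.symm)).add_const (κ * softDist 0 x)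
      have hgrad : HasGradientAt (fun y => S (y, t)) (ξ₀ + p • e + κ • q) x := by
        have g1 : HasDerivAt (fun s : ℝ => k * √(ε ^ 2 + (s - β * t - y₀) ^ 2)) (p * 1)
            (inner ℝ e x) :=
          hasDerivAt_sqrt_sq_add_sq hε k a _
            (((hasDerivAt_id _).sub_const (β * t)).sub_const y₀) ha.symm
        have g2 : HasDerivAt (fun r : ℝ => κ * r) κ (softDist 0 x) :=
          ((hasDerivAt_id _).const_mul κ).congr_deriv (mul_one _)
        have h1 := (((hasGradientAt_inner ξ₀ x).add' (hasGradientAt_const'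
          (-h ξ₀ * t + η / 2 * (t ^ 2 / (2 * t₀) - t)) x)).add'
          (HasGradientAt.comp_real g1 (hasGradientAt_inner e x))).add'
          (HasGradientAt.comp_real g2 hq')
        rw [add_zero, mul_one] at h1
        exact h1
      rw [hjOp_eq _ hder hgrad]
      obtain ⟨b1, b2⟩ := barrier_slope (a := a) hε hk.le
      rw [← hp] at b1 b2
      have h1 := htaylor p b1
      have h2 : ‖ξ₀ + p • e‖ ≤ ‖ξ₀‖ + k * ‖e‖ := by
        refine (norm_add_le _ _).trans ?_
        rw [norm_smul, Real.norm_eq_abs]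
        gcongr
      have h3 : ‖κ • q‖ ≤ κ := by
        rw [norm_smul, Real.norm_of_nonneg hκ0.le]
        nlinarith
      have h4 := abs_lt.1 (hκ _ _ h2 h3)
      have h5 : 0 < η / 2 * (t / t₀) := by positivity
      -- in the slab the potential is low; outside, the slope makes the Hamiltonian large
      by_cases hcase : |a| ≤ ε
      · have h6 := hslab x t (hfar x t ht.le htT.le hlt) ht htT hcase
        have h7 : 0 ≤ A * p ^ 2 := by positivity
        linarith
      · have h6 := (abs_le.1 (hV x t)).2
        have h7 : A * (k ^ 2 / 2) ≤ A * p ^ 2 := by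
          gcongr
          exact b2 (not_le.1 hcase).le
        linarith
  refine key.trans ?_
  simp only [hS, softDist_self, inner_zero_right]
  have h1 : √(ε ^ 2 + (0 - β * t₀ - y₀) ^ 2) ≤ ε + |β * t₀ + y₀| := by
    rw [Real.sqrt_le_left (by positivity)]
    have : (0 - β * t₀ - y₀) ^ 2 = |β * t₀ + y₀| ^ 2 := by rw [sq_abs]; ring
    rw [this]
    nlinarith [abs_nonneg (β * t₀ + y₀)]
  have h2 := mul_le_mul_of_nonneg_left h1 hk.le
  have h3 : η / 2 * (t₀ ^ 2 / (2 * t₀) - t₀) = -(η / 4 * t₀) := by field_simp; ring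
  rw [h3]
  linarith

/-! ### The environment as a function of the phases -/

/-- The spacing of the bars of generation `k`. -/
noncomputable def period (k : ℕ) : ℝ := 4 ^ (k ^ 2)

/-- The reciprocal of the scale at which the bars of generation `k` are dense while those of the
later generations are too far away to be seen: `period k ≪ zoom k ≪ period (k + 1)`. -/
noncomputable def zoom (k : ℕ) : ℝ := 4 ^ (k ^ 2 + k)

theorem period_pos (k : ℕ) : 0 < period k := by unfold period; positivity

theorem zoom_pos (k : ℕ) : 0 < zoom k := by unfold zoom; positivity

theorem one_le_zoom (k : ℕ) : 1 ≤ zoom k := one_le_pow₀ (by norm_num)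

theorem zoom_eq (k : ℕ) : zoom k = 4 ^ k * period k := by
  rw [zoom, period, pow_add, mul_comm]

theorem two_pow_mul_zoom_le {k j : ℕ} (hkj : k < j) : 2 ^ j * zoom k ≤ (1 / 2) ^ j * period j := by
  obtain ⟨n, rfl⟩ : ∃ n, j = n + 1 := ⟨j - 1, by omega⟩
  have h1 : zoom k ≤ zoom n := by
    have hkn : k ≤ n := by omega
    unfold zoom
    exact pow_le_pow_right₀ (by norm_num) (by gcongr)
  have h2 : period (n + 1) = 2 ^ (n + 1) * 2 ^ (n + 1) * zoom n := by
    rw [period, zoom, ← pow_add, show (4 : ℝ) = 2 ^ 2 by norm_num, ← pow_mul, ← pow_mul, ← pow_add]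
    congr 1
    ring
  rw [h2, one_div, inv_pow]
  have h3 : (0 : ℝ) < 2 ^ (n + 1) := by positivity
  rw [show ((2 : ℝ) ^ (n + 1))⁻¹ * (2 ^ (n + 1) * 2 ^ (n + 1) * zoom n) = 2 ^ (n + 1) * zoom n by
    field_simp]
  gcongr

/-- The profile of a bar of generation `k`, in terms of the phase: it equals one at distance at most
one from the bar, and vanishes at distance at least two. -/
noncomputable def barProfile (k : ℕ) (θ : UnitAddCircle) : ℝ := max 0 (min 1 (2 - period k * ‖θ‖))

theorem barProfile_nonneg (k : ℕ) (θ : UnitAddCircle) : 0 ≤ barProfile k θ := le_max_left _ _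

theorem barProfile_le_one (k : ℕ) (θ : UnitAddCircle) : barProfile k θ ≤ 1 :=
  max_le zero_le_one (min_le_left _ _)

theorem barProfile_eq_one {k : ℕ} {θ : UnitAddCircle} (h : period k * ‖θ‖ ≤ 1) :
    barProfile k θ = 1 := by
  rw [barProfile, min_eq_left (by linarith), max_eq_right zero_le_one]

theorem barProfile_eq_zero {k : ℕ} {θ : UnitAddCircle} (h : 2 ≤ period k * ‖θ‖) :
    barProfile k θ = 0 :=
  max_eq_left ((min_le_right _ _).trans (by linarith))

theorem abs_barProfile_sub_le (k : ℕ) (θ θ' : UnitAddCircle) :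
    |barProfile k θ - barProfile k θ'| ≤ period k * ‖θ - θ'‖ := by
  have h1 : |barProfile k θ - barProfile k θ'| ≤ |period k * ‖θ‖ - period k * ‖θ'‖| := by
    unfold barProfile
    refine (abs_max_sub_max_le_max _ _ _ _).trans ?_
    rw [sub_self, abs_zero, max_eq_right (abs_nonneg _)]
    refine (abs_min_sub_min_le_max _ _ _ _).trans ?_
    rw [sub_self, abs_zero, max_eq_right (abs_nonneg _), ← abs_neg]
    apply le_of_eq
    congr 1
    ring
  refine h1.trans ?_
  rw [← mul_sub, abs_mul, abs_of_pos (period_pos k)]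
  exact mul_le_mul_of_nonneg_left (abs_norm_sub_norm_le θ θ') (period_pos k).le

/-- The environment made of the bars of the first generations, given the phases of all of them.
Later generations override earlier ones; the bars of even generations carry the value `-1`, those
of odd generations the value `1`. Overriding by lattice operations, instead of by convex
combinations, keeps the Lipschitz constant under control where several bars overlap. -/
noncomputable def envUpTo (θ : ℕ → UnitAddCircle) : ℕ → ℝ
  | 0 => 0
  | k + 1 => if Even k then min (envUpTo θ k) (1 - 2 * barProfile k (θ k))
      else max (envUpTo θ k) (2 * barProfile k (θ k) - 1)

/-- The environment, with bars of all generations. The upper limit is a limit for almost all phases;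
taking it for all of them makes the environment defined and Lipschitz everywhere. -/
noncomputable def env (θ : ℕ → UnitAddCircle) : ℝ := limsup (envUpTo θ) atTop

theorem abs_envUpTo_le (θ : ℕ → UnitAddCircle) (k : ℕ) : |envUpTo θ k| ≤ 1 := by
  induction k with
  | zero => simp [envUpTo]
  | succ k ih =>
    have h0 := barProfile_nonneg k (θ k)
    have h1 := barProfile_le_one k (θ k)
    rw [abs_le] at ih ⊢
    rw [envUpTo]
    split_ifs
    · exact ⟨le_min ih.1 (by linarith), (min_le_left _ _).trans ih.2⟩
    · exact ⟨ih.1.trans (le_max_left _ _), max_le ih.2 (by linarith)⟩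

theorem envUpTo_bounded_above (θ : ℕ → UnitAddCircle) :
    IsBoundedUnder (· ≤ ·) atTop (envUpTo θ) :=
  isBoundedUnder_of_eventually_le (Eventually.of_forall fun k => (abs_le.1 (abs_envUpTo_le θ k)).2)

theorem envUpTo_cobounded (θ : ℕ → UnitAddCircle) :
    IsCoboundedUnder (· ≤ ·) atTop (envUpTo θ) :=
  (isBoundedUnder_of_eventually_ge
    (Eventually.of_forall fun k => (abs_le.1 (abs_envUpTo_le θ k)).1)).isCoboundedUnder_le

theorem abs_env_le (θ : ℕ → UnitAddCircle) : |env θ| ≤ 1 := by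
  rw [abs_le]
  constructor
  · exact le_limsup_of_le (envUpTo_bounded_above θ) fun b hb => by
      obtain ⟨k, hk⟩ := hb.exists
      exact (abs_le.1 (abs_envUpTo_le θ k)).1.trans hk
  · exact limsup_le_of_le (envUpTo_cobounded θ)
      (Eventually.of_forall fun k => (abs_le.1 (abs_envUpTo_le θ k)).2)

theorem abs_envUpTo_sub_le {θ θ' : ℕ → UnitAddCircle} {D : ℝ} (hD0 : 0 ≤ D)
    (hD : ∀ k, period k * ‖θ k - θ' k‖ ≤ D) (k : ℕ) : |envUpTo θ k - envUpTo θ' k| ≤ 2 * D := by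
  induction k with
  | zero => simpa [envUpTo] using hD0
  | succ k ih =>
    have h1 := abs_le.1 ((abs_barProfile_sub_le k (θ k) (θ' k)).trans (hD k))
    rw [envUpTo, envUpTo]
    split_ifs
    · refine (abs_min_sub_min_le_max _ _ _ _).trans (max_le ih ?_)
      rw [abs_le]
      constructor <;> linarith
    · refine (abs_max_sub_max_le_max _ _ _ _).trans (max_le ih ?_)
      rw [abs_le]
      constructor <;> linarith

theorem env_le_add {θ θ' : ℕ → UnitAddCircle} {D : ℝ} (hD0 : 0 ≤ D)
    (hD : ∀ k, period k * ‖θ k - θ' k‖ ≤ D) : env θ ≤ env θ' + 2 * D := by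
  refine le_of_forall_pos_le_add fun δ hδ => ?_
  refine limsup_le_of_le (envUpTo_cobounded θ) ?_
  have h1 : ∀ᶠ k in atTop, envUpTo θ' k < env θ' + δ :=
    eventually_lt_of_limsup_lt (lt_add_of_pos_right _ hδ) (envUpTo_bounded_above θ')
  filter_upwards [h1] with k hk
  linarith [(abs_le.1 (abs_envUpTo_sub_le hD0 hD k)).2]

theorem abs_env_sub_le {θ θ' : ℕ → UnitAddCircle} {D : ℝ} (hD0 : 0 ≤ D)
    (hD : ∀ k, period k * ‖θ k - θ' k‖ ≤ D) : |env θ - env θ'| ≤ 2 * D := by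
  have h1 := env_le_add hD0 hD
  have h2 := env_le_add (θ := θ') (θ' := θ) hD0 fun k => by rw [norm_sub_rev]; exact hD k
  rw [abs_le]
  constructor <;> linarith

theorem measurable_envUpTo (k : ℕ) : Measurable fun θ => envUpTo θ k := by
  induction k with
  | zero => exact measurable_const
  | succ k ih =>
    have h1 : Measurable fun θ : ℕ → UnitAddCircle => barProfile k (θ k) := by
      unfold barProfile
      exact measurable_const.max (measurable_const.min
        (measurable_const.sub ((measurable_norm.comp (measurable_pi_apply k)).const_mul _)))
    by_cases hk : Even k
    · simp only [envUpTo, if_pos hk]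
      exact ih.min (measurable_const.sub (h1.const_mul 2))
    · simp only [envUpTo, if_neg hk]
      exact ih.max ((h1.const_mul 2).sub_const 1)

theorem measurable_env : Measurable env := Measurable.limsup measurable_envUpTo

/-- Generations whose bars are far away are not seen. -/
theorem env_eq_envUpTo {θ : ℕ → UnitAddCircle} {k : ℕ}
    (h : ∀ j, k < j → 2 ≤ period j * ‖θ j‖) : env θ = envUpTo θ (k + 1) := by
  have h1 : ∀ j, k + 1 ≤ j → envUpTo θ j = envUpTo θ (k + 1) := by
    intro j hj
    induction j, hj using Nat.le_induction with
    | base => rfl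
    | succ j hj ih =>
      have h2 := abs_le.1 (abs_envUpTo_le θ j)
      rw [← ih, envUpTo, barProfile_eq_zero (h j (by omega))]
      split_ifs
      · exact min_eq_left (by linarith)
      · exact max_eq_left (by linarith)
  exact (tendsto_const_nhds.congr' (by
    filter_upwards [eventually_ge_atTop (k + 1)] with j hj
    exact (h1 j hj).symm)).limsup_eq

theorem env_le_of_even {θ : ℕ → UnitAddCircle} {k : ℕ} (hk : Even k)
    (h : ∀ j, k < j → 2 ≤ period j * ‖θ j‖) (hbar : period k * ‖θ k‖ ≤ 1) : env θ ≤ -1 := by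
  rw [env_eq_envUpTo h, envUpTo, if_pos hk, barProfile_eq_one hbar]
  exact (min_le_right _ _).trans (by norm_num)

theorem le_env_of_odd {θ : ℕ → UnitAddCircle} {k : ℕ} (hk : ¬Even k)
    (h : ∀ j, k < j → 2 ≤ period j * ‖θ j‖) (hbar : period k * ‖θ k‖ ≤ 1) : 1 ≤ env θ := by
  rw [env_eq_envUpTo h, envUpTo, if_neg hk, barProfile_eq_one hbar]
  exact le_trans (by norm_num) (le_max_right _ _)

/-! ### The probability space of phases -/

section Phases

variable {d : ℕ} (ℓ : ℕ → Eucl d × ℝ →L[ℝ] ℝ)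

/-- The phases, relative to the bars of all generations, of a translation of space-time; the bars of
generation `k` are the level sets of `ℓ k` at the multiples of `period k`. -/
noncomputable def phaseHom : Eucl d × ℝ →+ (ℕ → UnitAddCircle) where
  toFun z k := ((ℓ k z / period k : ℝ) : UnitAddCircle)
  map_zero' := by funext k; simp
  map_add' z w := by funext k; simp [add_div]

/-- The sample space: the closed group of phases generated by the translations. -/
noncomputable def phaseGroup : AddSubgroup (ℕ → UnitAddCircle) :=
  (phaseHom ℓ).range.topologicalClosure

/-- The homomorphism from the translations to the sample space. -/
noncomputable def toPhaseGroup : Eucl d × ℝ →+ phaseGroup ℓ :=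
  (phaseHom ℓ).codRestrict (phaseGroup ℓ) fun z =>
    AddSubgroup.le_topologicalClosure _ ⟨z, rfl⟩

/-- Space-time acts on the phases by translation. -/
noncomputable instance phaseAction : AddAction (Eucl d × ℝ) (phaseGroup ℓ) :=
  AddAction.compHom (phaseGroup ℓ) (toPhaseGroup ℓ)

theorem vadd_phase_def (z : Eucl d × ℝ) (ω : phaseGroup ℓ) : z +ᵥ ω = toPhaseGroup ℓ z + ω := rfl

theorem vadd_phase_apply (z : Eucl d × ℝ) (ω : phaseGroup ℓ) (k : ℕ) :
    (↑(z +ᵥ ω) : ℕ → UnitAddCircle) k = ((ℓ k z / period k : ℝ) : UnitAddCircle) + ω.1 k := rfl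

instance compactSpace_phaseGroup : CompactSpace (phaseGroup ℓ) :=
  isCompact_iff_compactSpace.1
    (AddSubgroup.isClosed_topologicalClosure (phaseHom ℓ).range).isCompact

instance secondCountableTopology_phaseGroup : SecondCountableTopology (phaseGroup ℓ) :=
  TopologicalSpace.Subtype.secondCountableTopology (phaseGroup ℓ : Set (ℕ → UnitAddCircle))

theorem denseRange_toPhaseGroup : DenseRange (toPhaseGroup ℓ) := by
  intro ω
  rw [closure_subtype]
  have h : (Subtype.val '' Set.range (toPhaseGroup ℓ) : Set (ℕ → UnitAddCircle)) =
      ((phaseHom ℓ).range : Set (ℕ → UnitAddCircle)) := by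
    rw [← Set.range_comp]; rfl
  rw [h]
  exact ω.2

theorem continuous_toPhaseGroup : Continuous (toPhaseGroup ℓ) := by
  refine Continuous.subtype_mk (continuous_pi fun k => ?_) _
  exact (AddCircle.continuous_mk' 1).comp ((ℓ k).continuous.div_const _)

/-- The law of the environment: the Haar probability measure on the phases. -/
noncomputable def phaseMeasure : Measure (phaseGroup ℓ) := Measure.addHaarMeasure ⊤

theorem phaseMeasure_univ : phaseMeasure ℓ Set.univ = 1 :=
  Measure.addHaarMeasure_self (K₀ := (⊤ : TopologicalSpace.PositiveCompacts (phaseGroup ℓ)))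

instance isProbabilityMeasure_phaseMeasure : IsProbabilityMeasure (phaseMeasure ℓ) :=
  ⟨phaseMeasure_univ ℓ⟩

instance isAddHaarMeasure_phaseMeasure : (phaseMeasure ℓ).IsAddHaarMeasure :=
  Measure.isAddHaarMeasure_addHaarMeasure _

theorem measurableVAdd₂_phaseGroup : MeasurableVAdd₂ (Eucl d × ℝ) (phaseGroup ℓ) :=
  ⟨(((continuous_toPhaseGroup ℓ).comp continuous_fst).add continuous_snd).measurable⟩

theorem ergodicVAdd_phaseMeasure : ErgodicVAdd (Eucl d × ℝ) (phaseGroup ℓ) (phaseMeasure ℓ) where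
  measure_preimage_vadd z s _ := by
    simp only [vadd_phase_def]
    exact measure_preimage_add (phaseMeasure ℓ) (toPhaseGroup ℓ z) s
  aeconst_of_forall_preimage_vadd_ae_eq {s} hsm hs := by
    have : ErgodicVAdd (phaseGroup ℓ) (phaseGroup ℓ) (phaseMeasure ℓ) :=
      instErgodicVAddOfIsAddLeftInvariant
    refine aeconst_of_dense_setOfPred_preimage_vadd_ae (M := phaseGroup ℓ)
      hsm.nullMeasurableSet ?_
    refine (denseRange_toPhaseGroup ℓ).mono ?_
    rintro _ ⟨z, rfl⟩
    exact hs z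

/-- Each phase is uniformly distributed. -/
theorem measurePreserving_phase {k : ℕ} (hk : ℓ k ≠ 0) :
    MeasurePreserving (fun ω : phaseGroup ℓ => ω.1 k) (phaseMeasure ℓ)
      (volume : Measure UnitAddCircle) := by
  let f : phaseGroup ℓ →+ UnitAddCircle := (Pi.evalAddMonoidHom _ k).comp (phaseGroup ℓ).subtype
  refine AddMonoidHom.measurePreserving (f := f)
    ((continuous_apply k).comp continuous_subtype_val) ?_ ?_
  · intro θ
    obtain ⟨s, rfl⟩ := QuotientAddGroup.mk_surjective θ
    obtain ⟨v, hv⟩ : ∃ v, ℓ k v ≠ 0 := by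
      by_contra! h
      exact hk (ContinuousLinearMap.ext h)
    refine ⟨toPhaseGroup ℓ ((s * period k / ℓ k v) • v), ?_⟩
    change ((ℓ k ((s * period k / ℓ k v) • v) / period k : ℝ) : UnitAddCircle) = (s : UnitAddCircle)
    have := (period_pos k).ne'
    congr 1
    rw [map_smul, smul_eq_mul]
    field_simp
  · rw [phaseMeasure_univ]; simp

/-- Almost surely, the bars of late generations stay away from the origin at a distance much larger
than the previous zoom. -/
theorem ae_eventually_phase_large (hℓ : ∀ k, ℓ k ≠ 0) :
    ∀ᵐ ω ∂phaseMeasure ℓ, ∀ᶠ k in atTop, (1 / 2 : ℝ) ^ k < ‖ω.1 k‖ := by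
  have h1 : ∀ k, phaseMeasure ℓ {ω | ‖ω.1 k‖ ≤ (1 / 2 : ℝ) ^ k} ≤
      ENNReal.ofReal (2 * (1 / 2) ^ k) := by
    intro k
    have h2 := (measurePreserving_phase ℓ (hℓ k)).measure_preimage
      (s := Metric.closedBall (0 : UnitAddCircle) ((1 / 2 : ℝ) ^ k))
      Metric.isClosed_closedBall.measurableSet.nullMeasurableSet
    rw [AddCircle.volume_closedBall] at h2
    have h3 : {ω : phaseGroup ℓ | ‖ω.1 k‖ ≤ (1 / 2 : ℝ) ^ k} =
        (fun ω : phaseGroup ℓ => ω.1 k) ⁻¹' Metric.closedBall 0 ((1 / 2 : ℝ) ^ k) := by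
      ext ω; simp
    rw [h3, h2]
    exact ENNReal.ofReal_le_ofReal (min_le_right _ _)
  have h2 : ∑' k, phaseMeasure ℓ {ω | ‖ω.1 k‖ ≤ (1 / 2 : ℝ) ^ k} ≠ ⊤ := by
    refine ne_top_of_le_ne_top ?_ (ENNReal.tsum_le_tsum h1)
    rw [← ENNReal.ofReal_tsum_of_nonneg (fun k => by positivity)
      ((summable_geometric_of_lt_one (by norm_num) (by norm_num)).mul_left 2)]
    exact ENNReal.ofReal_ne_top
  filter_upwards [ae_eventually_notMem h2] with ω hω
  filter_upwards [hω] with k hk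
  exact not_le.1 hk

/-- The random potential. -/
noncomputable def potential (η : ℝ) (x : Eucl d) (t : ℝ) (ω : phaseGroup ℓ) : ℝ :=
  η * env (↑(((x, t) : Eucl d × ℝ) +ᵥ ω) : ℕ → UnitAddCircle)

theorem abs_potential_le {η : ℝ} (hη : 0 ≤ η) (x : Eucl d) (t : ℝ) (ω : phaseGroup ℓ) :
    |potential ℓ η x t ω| ≤ η := by
  rw [potential, abs_mul, abs_of_nonneg hη]
  exact mul_le_of_le_one_right hη (abs_env_le _)

theorem abs_potential_sub_le {η Λ : ℝ} (hη : 0 ≤ η) (hΛ : ∀ k, ‖ℓ k‖ ≤ Λ) (z w : Eucl d × ℝ)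
    (ω : phaseGroup ℓ) :
    |potential ℓ η z.1 z.2 ω - potential ℓ η w.1 w.2 ω| ≤ η * (2 * Λ) * ‖z - w‖ := by
  have hΛ0 : 0 ≤ Λ := (norm_nonneg _).trans (hΛ 0)
  rw [potential, potential, ← mul_sub, abs_mul, abs_of_nonneg hη, mul_assoc, mul_assoc]
  refine mul_le_mul_of_nonneg_left (abs_env_sub_le (by positivity) fun k => ?_) hη
  rw [vadd_phase_apply, vadd_phase_apply, add_sub_add_right_eq_sub, ← AddCircle.coe_sub, ← sub_div,
    ← map_sub]
  have h1 : ‖((ℓ k ((z.1, z.2) - (w.1, w.2)) / period k : ℝ) : UnitAddCircle)‖ ≤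
      |ℓ k (z - w)| / period k := by
    refine (QuotientAddGroup.norm_mk_le_norm).trans ?_
    rw [Real.norm_eq_abs, abs_div, abs_of_pos (period_pos k)]
  refine (mul_le_mul_of_nonneg_left h1 (period_pos k).le).trans ?_
  rw [mul_div_cancel₀ _ (period_pos k).ne']
  exact ((ℓ k).le_opNorm _).trans (by gcongr; exact hΛ k)

theorem isBoundedLipschitzField_potential {η Λ : ℝ} (hη : 0 ≤ η) (hΛ : ∀ k, ‖ℓ k‖ ≤ Λ) :
    IsBoundedLipschitzField (potential ℓ η) := by
  have hΛ0 : 0 ≤ Λ := (norm_nonneg _).trans (hΛ 0)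
  refine ⟨⟨η, fun x t ω => abs_potential_le ℓ hη x t ω⟩, (η * (2 * Λ)).toNNReal, fun ω => ?_⟩
  refine LipschitzWith.of_dist_le_mul fun z w => ?_
  rw [Real.coe_toNNReal _ (by positivity), Real.dist_eq, dist_eq_norm]
  exact abs_potential_sub_le ℓ hη hΛ z w ω

theorem isStationaryErgodicField_potential (η : ℝ) :
    IsStationaryErgodicField (phaseMeasure ℓ) (potential ℓ η) where
  isProbability := inferInstance
  measurable_action := measurableVAdd₂_phaseGroup ℓ
  ergodic := ergodicVAdd_phaseMeasure ℓ
  measurable x t := by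
    have h : Measurable fun ω : phaseGroup ℓ => (((x, t) : Eucl d × ℝ) +ᵥ ω) :=
      (continuous_const.add continuous_id).measurable
    exact (measurable_env.comp (measurable_subtype_coe.comp h)).const_mul η
  stationary x y t s ω := by
    rw [potential, potential, ← Prod.mk_add_mk, add_vadd]

/-- Zooming out by the factor `zoom k`, close to any given level `Y` one sees a bar of
generation `k` that is not overridden by later generations. -/
theorem eventually_exists_bar {Λ : ℝ} (hΛ : ∀ k, ‖ℓ k‖ ≤ Λ) {ω : phaseGroup ℓ}
    (hω : ∀ᶠ k in atTop, (1 / 2 : ℝ) ^ k < ‖ω.1 k‖) (Q : ℝ) :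
    ∀ᶠ k in atTop, ∀ Y : ℝ, ∃ y₀ : ℝ, |Y - y₀| ≤ (1 / 4) ^ k ∧ ∀ z : Eucl d × ℝ, ‖z‖ ≤ Q →
      |ℓ k z - y₀| ≤ (zoom k)⁻¹ →
      (Even k → env (↑((zoom k • z) +ᵥ ω) : ℕ → UnitAddCircle) ≤ -1) ∧
      (¬Even k → 1 ≤ env (↑((zoom k • z) +ᵥ ω) : ℕ → UnitAddCircle)) := by
  have hΛ0 : 0 ≤ Λ := (norm_nonneg _).trans (hΛ 0)
  obtain ⟨n₀, hn₀⟩ := eventually_atTop.1 hω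
  have h2 : ∀ᶠ k : ℕ in atTop, Λ * Q + 2 ≤ (2 : ℝ) ^ k :=
    (tendsto_pow_atTop_atTop_of_one_lt one_lt_two).eventually_ge_atTop _
  filter_upwards [h2, eventually_ge_atTop n₀] with k hk hkn Y
  obtain ⟨s, hs⟩ := QuotientAddGroup.mk_surjective (ω.1 k)
  have hz := zoom_pos k
  have hp := period_pos k
  have hzp : zoom k / period k = 4 ^ k := by rw [zoom_eq]; field_simp
  set n : ℤ := round (s + Y * (zoom k / period k)) with hn
  set y₀ : ℝ := (period k / zoom k) * (n - s) with hy₀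
  have hy : ∀ y : ℝ, (zoom k / period k) * (y - y₀) = s + y * (zoom k / period k) - n := by
    intro y
    rw [hy₀]
    field_simp
    ring
  refine ⟨y₀, ?_, fun z hzQ hbar => ?_⟩
  · have h3 : |(zoom k / period k) * (Y - y₀)| ≤ 1 / 2 := by
      rw [hy Y]; exact abs_sub_round _
    rw [abs_mul, hzp, abs_of_pos (by positivity)] at h3
    rw [one_div, inv_pow, ← one_div, le_div_iff₀ (by positivity)]
    linarith
  · have hfar : ∀ j, k < j → 2 ≤ period j * ‖(↑((zoom k • z) +ᵥ ω) : ℕ → UnitAddCircle) j‖ := by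
      intro j hj
      rw [vadd_phase_apply]
      have h3 : ‖((ℓ j (zoom k • z) / period j : ℝ) : UnitAddCircle)‖ ≤
          zoom k * (Λ * Q) / period j := by
        refine (QuotientAddGroup.norm_mk_le_norm).trans ?_
        rw [Real.norm_eq_abs, abs_div, abs_of_pos (period_pos j), map_smul, smul_eq_mul, abs_mul,
          abs_of_pos hz]
        have h4 : |ℓ j z| ≤ Λ * Q := ((ℓ j).le_opNorm z).trans (by gcongr; exact hΛ j)
        have := period_pos j
        gcongr
      have h4 := hn₀ j (by omega)
      have h5 : ‖ω.1 j‖ - ‖((ℓ j (zoom k • z) / period j : ℝ) : UnitAddCircle)‖ ≤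
          ‖((ℓ j (zoom k • z) / period j : ℝ) : UnitAddCircle) + ω.1 j‖ := by
        have := norm_sub_norm_le (ω.1 j) (-((ℓ j (zoom k • z) / period j : ℝ) : UnitAddCircle))
        rwa [norm_neg, sub_neg_eq_add, add_comm (ω.1 j)] at this
      have h6 := two_pow_mul_zoom_le hj
      have h7 : (2 : ℝ) ^ k ≤ 2 ^ j := pow_le_pow_right₀ one_le_two hj.le
      have h8 : period j * ((1 / 2) ^ j - zoom k * (Λ * Q) / period j) ≤
          period j * ‖((ℓ j (zoom k • z) / period j : ℝ) : UnitAddCircle) + ω.1 j‖ := by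
        have := (period_pos j).le
        gcongr
        linarith
      refine le_trans ?_ h8
      rw [mul_sub, mul_div_cancel₀ _ (period_pos j).ne']
      nlinarith [one_le_zoom k]
    have hnear : period k * ‖(↑((zoom k • z) +ᵥ ω) : ℕ → UnitAddCircle) k‖ ≤ 1 := by
      rw [vadd_phase_apply, ← hs]
      have h3 : (((ℓ k (zoom k • z) / period k : ℝ) : UnitAddCircle) + (s : UnitAddCircle)) =
          ((s + ℓ k z * (zoom k / period k) - n : ℝ) : UnitAddCircle) := by
        rw [map_smul, smul_eq_mul, ← AddCircle.coe_add, AddCircle.coe_sub]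
        have h4 : ((n : ℝ) : UnitAddCircle) = 0 := by
          rw [AddCircle.coe_eq_zero_iff]; exact ⟨n, by simp⟩
        rw [h4, sub_zero]
        congr 1
        ring
      have h5 : ‖(((ℓ k (zoom k • z) / period k : ℝ) : UnitAddCircle) + (s : UnitAddCircle))‖ ≤
          zoom k / period k * (zoom k)⁻¹ := by
        rw [h3]
        refine (QuotientAddGroup.norm_mk_le_norm).trans ?_
        rw [Real.norm_eq_abs, ← hy, abs_mul, abs_of_pos (by positivity)]
        gcongr
      refine (mul_le_mul_of_nonneg_left h5 hp.le).trans (le_of_eq ?_)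
      field_simp
    exact ⟨fun he => env_le_of_even he hfar hnear, fun ho => le_env_of_odd ho hfar hnear⟩

end Phases

/-! ### Second-order behaviour of the Hamiltonian along eigenvectors, and non-homogenization -/

/-- A `C²` function with positive second derivative in the direction `e` lies locally above a
strictly convex parabola along that direction. -/
theorem exists_parabola_le {d : ℕ} {h : Eucl d → ℝ} (hh : ContDiff ℝ 2 h) {ξ₀ e : Eucl d}
    (hpos : 0 < fderiv ℝ (fderiv ℝ h) ξ₀ e e) :
    ∃ A > 0, ∃ k > 0, ∀ p : ℝ, |p| ≤ k →
      h ξ₀ + p * fderiv ℝ h ξ₀ e + A * p ^ 2 ≤ h (ξ₀ + p • e) := by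
  set D := fderiv ℝ (fderiv ℝ h) ξ₀ e e with hD
  set b := fderiv ℝ h ξ₀ e with hb
  have hline : ∀ s : ℝ, HasDerivAt (fun s : ℝ => ξ₀ + s • e) e s := fun s => by
    simpa using ((hasDerivAt_id s).smul_const e).const_add ξ₀
  have h1 : ∀ s : ℝ, HasDerivAt (fun s : ℝ => h (ξ₀ + s • e)) (fderiv ℝ h (ξ₀ + s • e) e) s :=
    fun s => (hh.differentiable two_ne_zero _).hasFDerivAt.comp_hasDerivAt s (hline s)
  have h2 : HasDerivAt (fun s : ℝ => fderiv ℝ h (ξ₀ + s • e) e) D 0 := by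
    have h3 : Differentiable ℝ (fderiv ℝ h) :=
      (hh.fderiv_right (m := 1) (by norm_num)).differentiable one_ne_zero
    have h4 := (h3 (ξ₀ + (0 : ℝ) • e)).hasFDerivAt.comp_hasDerivAt (0 : ℝ) (hline 0)
    rw [zero_smul, add_zero] at h4
    simpa using h4.clm_apply (hasDerivAt_const (0 : ℝ) e)
  set G : ℝ → ℝ := fun s => h (ξ₀ + s • e) - s * b - D / 4 * s ^ 2 with hG
  have hG1 : ∀ s, HasDerivAt G (fderiv ℝ h (ξ₀ + s • e) e - b - D / 4 * (2 * s)) s := by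
    intro s
    have h3 := ((h1 s).sub ((hasDerivAt_id s).mul_const b)).sub
      (((hasDerivAt_id s).pow 2).const_mul (D / 4))
    exact h3.congr_deriv (by simp)
  have hG' : deriv G = fun s => fderiv ℝ h (ξ₀ + s • e) e - b - D / 4 * (2 * s) :=
    funext fun s => (hG1 s).deriv
  have hG2 : HasDerivAt (deriv G) (D - D / 4 * 2) 0 := by
    rw [hG']
    have h3 := (h2.sub_const b).sub (((hasDerivAt_id (0 : ℝ)).const_mul 2).const_mul (D / 4))
    exact h3.congr_deriv (by simp)
  have hmin : IsLocalMin G 0 := by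
    refine isLocalMin_of_deriv_deriv_pos ?_ ?_ (hG1 0).continuousAt
    · rw [hG2.deriv]; linarith
    · rw [hG']; simp [hb]
  obtain ⟨k, hk, hk'⟩ := Metric.nhds_basis_closedBall.eventually_iff.1 hmin
  refine ⟨D / 4, by positivity, k, hk, fun p hp => ?_⟩
  have h3 := hk' (show p ∈ Metric.closedBall (0 : ℝ) k by simpa using hp)
  simp only [hG, zero_smul, add_zero, zero_mul, sub_zero] at h3
  norm_num at h3
  linarith

theorem fderiv_fderiv_eq_hessianMatrix {d : ℕ} (h : Eucl d → ℝ) (ξ v w : Eucl d) :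
    fderiv ℝ (fderiv ℝ h) ξ v w = ∑ i, ∑ j, v i * hessianMatrix h ξ i j * w j := by
  have hv : ∀ v : Eucl d, v = ∑ i, v i • EuclideanSpace.single i (1 : ℝ) := fun v => by
    simpa using ((EuclideanSpace.basisFun (Fin d) ℝ).sum_repr v).symm
  conv_lhs => rw [hv v, hv w]
  simp only [map_sum, map_smul, _root_.sum_apply, _root_.smul_apply,
    smul_eq_mul, Finset.mul_sum, hessianMatrix, Matrix.of_apply]
  rw [Finset.sum_comm]
  refine Finset.sum_congr rfl fun i _ => Finset.sum_congr rfl fun j _ => ?_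
  ring

/-- The second derivative in the direction of a normalized eigenvector is the eigenvalue. -/
theorem fderiv_fderiv_eigenvector {d : ℕ} {h : Eucl d → ℝ} (hh : ContDiff ℝ 2 h) (ξ : Eucl d)
    (i : Fin d) :
    fderiv ℝ (fderiv ℝ h) ξ ((hessianMatrix_isHermitian hh ξ).eigenvectorBasis i)
      ((hessianMatrix_isHermitian hh ξ).eigenvectorBasis i) =
      (hessianMatrix_isHermitian hh ξ).eigenvalues i := by
  set v := (hessianMatrix_isHermitian hh ξ).eigenvectorBasis i with hv
  have h1 := (hessianMatrix_isHermitian hh ξ).mulVec_eigenvectorBasis i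
  have h2 : ∑ j, v j * v j = 1 := by
    have h3 : inner ℝ v v = (1 : ℝ) := by
      rw [real_inner_self_eq_norm_sq, hv, OrthonormalBasis.norm_eq_one]; norm_num
    rw [← h3, PiLp.inner_apply]
    simp [sq]
  rw [fderiv_fderiv_eq_hessianMatrix]
  have h4 : ∀ a, ∑ j, hessianMatrix h ξ a j * v j =
      (hessianMatrix_isHermitian hh ξ).eigenvalues i * v a := by
    intro a
    have := congrFun h1 a
    simpa [Matrix.mulVec, dotProduct] using this
  calc ∑ a, ∑ j, v a * hessianMatrix h ξ a j * v j
      = ∑ a, v a * ((hessianMatrix_isHermitian hh ξ).eigenvalues i * v a) := by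
        refine Finset.sum_congr rfl fun a _ => ?_
        rw [← h4, Finset.mul_sum]
        exact Finset.sum_congr rfl fun j _ => by ring
    _ = (hessianMatrix_isHermitian hh ξ).eigenvalues i * ∑ a, v a * v a := by
        rw [Finset.mul_sum]
        exact Finset.sum_congr rfl fun a _ => by ring
    _ = _ := by rw [h2, mul_one]

/-- The linear form on space-time with the slabs `⟨e, x⟩ - β t = const` as level sets. -/
noncomputable def slabForm {d : ℕ} (e : Eucl d) (β : ℝ) : Eucl d × ℝ →L[ℝ] ℝ :=
  (innerSL ℝ e).comp (ContinuousLinearMap.fst ℝ (Eucl d) ℝ) -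
    β • ContinuousLinearMap.snd ℝ (Eucl d) ℝ

theorem slabForm_apply {d : ℕ} (e : Eucl d) (β : ℝ) (x : Eucl d) (t : ℝ) :
    slabForm e β (x, t) = inner ℝ e x - β * t := by
  simp [slabForm]

theorem slabForm_ne_zero {d : ℕ} {e : Eucl d} (he : e ≠ 0) (β : ℝ) : slabForm e β ≠ 0 := by
  intro h0
  have h1 := slabForm_apply e β e 0
  rw [h0] at h1
  simp at h1
  exact he (by simpa using h1.symm)

theorem tendsto_inv_zoom : Tendsto (fun k => (zoom k)⁻¹) atTop (𝓝 0) := by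
  refine squeeze_zero (fun k => (inv_pos.2 (zoom_pos k)).le) (fun k => ?_)
    (tendsto_pow_atTop_nhds_zero_of_lt_one (r := (1 / 4 : ℝ)) (by norm_num) (by norm_num))
  rw [one_div, inv_pow]
  refine inv_anti₀ (by positivity) ?_
  exact pow_le_pow_right₀ (by norm_num) (Nat.le_add_left _ _)

/-- A property of the scales of all large generations in an infinite class occurs at arbitrarily
small scales. -/
theorem frequently_small_scale {p : ℕ → Prop} (hp : ∃ᶠ k in atTop, p k) {q : ℝ → Prop}
    (h : ∀ᶠ k in atTop, p k → q (zoom k)⁻¹) : ∃ᶠ ε in 𝓝[>] (0 : ℝ), q ε := by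
  have h1 : Tendsto (fun k => (zoom k)⁻¹) atTop (𝓝[>] 0) :=
    tendsto_nhdsWithin_iff.2 ⟨tendsto_inv_zoom, Eventually.of_forall fun k => inv_pos.2 (zoom_pos k)⟩
  exact h1.frequently ((hp.and_eventually h).mono fun k hk => hk.2 hk.1)

section Main

variable {d : ℕ} {h : Eucl d → ℝ} {ξ₀ e f : Eucl d} {β γ : ℝ}

/-- The bars of even generations are slabs attracting the minimizing player, those of odd
generations are slabs attracting the maximizing player. -/
noncomputable def barForms (e f : Eucl d) (β γ : ℝ) (k : ℕ) : Eucl d × ℝ →L[ℝ] ℝ :=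
  if Even k then slabForm e β else slabForm f γ

theorem barForms_norm_le (e f : Eucl d) (β γ : ℝ) (k : ℕ) :
    ‖barForms e f β γ k‖ ≤ max ‖slabForm e β‖ ‖slabForm f γ‖ := by
  unfold barForms
  split_ifs
  · exact le_max_left _ _
  · exact le_max_right _ _

theorem barForms_ne_zero (he : e ≠ 0) (hf : f ≠ 0) (k : ℕ) : barForms e f β γ k ≠ 0 := by
  unfold barForms
  split_ifs
  · exact slabForm_ne_zero he β
  · exact slabForm_ne_zero hf γ

theorem scaledHamiltonian_potential (ℓ : ℕ → Eucl d × ℝ →L[ℝ] ℝ) (η ε : ℝ) (ω : phaseGroup ℓ) :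
    scaledHamiltonian h (fun x t => potential ℓ η x t ω) ε =
      fun ξ x t => h ξ - potential ℓ η (ε⁻¹ • x) (t / ε) ω := rfl

/-- The initial value problem is well posed for all phases and at all scales. -/
theorem wellPosed (hh : Continuous h) (ξ₀ : Eucl d) (ℓ : ℕ → Eucl d × ℝ →L[ℝ] ℝ) {η Λ : ℝ}
    (hη : 0 ≤ η) (hΛ : ∀ k, ‖ℓ k‖ ≤ Λ) (ω : phaseGroup ℓ) {ε : ℝ} (hε : 0 < ε) :
    ∃ u : Eucl d × ℝ → ℝ,
      IsViscositySolution (scaledHamiltonian h (fun x t => potential ℓ η x t ω) ε) ξ₀ u ∧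
      ∀ w : Eucl d × ℝ → ℝ,
        IsViscositySolution (scaledHamiltonian h (fun x t => potential ℓ η x t ω) ε) ξ₀ w →
        ∀ (x : Eucl d) (t : ℝ), 0 ≤ t → w (x, t) = u (x, t) := by
  have hΛ0 : 0 ≤ Λ := (norm_nonneg _).trans (hΛ 0)
  have hL : 0 ≤ η * (2 * Λ) * ε⁻¹ := by positivity
  have hV : ∀ (x y : Eucl d) (t s : ℝ), |potential ℓ η (ε⁻¹ • x) (t / ε) ω -
      potential ℓ η (ε⁻¹ • y) (s / ε) ω| ≤ η * (2 * Λ) * ε⁻¹ * (‖x - y‖ + |t - s|) := by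
    intro x y t s
    refine (abs_potential_sub_le ℓ hη hΛ (ε⁻¹ • x, t / ε) (ε⁻¹ • y, s / ε) ω).trans ?_
    rw [mul_assoc (η * (2 * Λ))]
    refine mul_le_mul_of_nonneg_left ?_ (by positivity)
    rw [Prod.mk_sub_mk, ← smul_sub, ← sub_div, Prod.norm_mk, norm_smul, Real.norm_eq_abs,
      Real.norm_eq_abs, abs_div, abs_inv, abs_of_pos hε, mul_add, div_eq_inv_mul]
    exact max_le_add_of_nonneg (by positivity) (by positivity)
  have hB : ∀ (x : Eucl d) (t : ℝ), |potential ℓ η (ε⁻¹ • x) (t / ε) ω| ≤ η := fun x t =>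
    abs_potential_le ℓ hη _ _ ω
  rw [scaledHamiltonian_potential]
  obtain ⟨u, hu⟩ := exists_isViscositySolution hh hL hV hB ξ₀
  exact ⟨u, hu, fun w hw x t ht => hw.unique hh hL hV hB hu x t ht⟩

/-- The rescaled potential is the environment seen after zooming out. -/
theorem potential_zoom (ℓ : ℕ → Eucl d × ℝ →L[ℝ] ℝ) (η : ℝ) (ω : phaseGroup ℓ) (k : ℕ)
    (x : Eucl d) (t : ℝ) : potential ℓ η ((zoom k)⁻¹⁻¹ • x) (t / (zoom k)⁻¹) ω =
      η * env (↑((zoom k • ((x, t) : Eucl d × ℝ)) +ᵥ ω) : ℕ → UnitAddCircle) := by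
  rw [potential, inv_inv, div_inv_eq_mul, Prod.smul_mk, smul_eq_mul, mul_comm t]

/-- The error in the barrier estimate vanishes at the selected scales. -/
theorem eventually_error_lt (K : ℝ) {δ : ℝ} (hδ : 0 < δ) :
    ∀ᶠ k : ℕ in atTop, K * ((zoom k)⁻¹ + (1 / 4) ^ k) < δ := by
  have h1 := (tendsto_inv_zoom.add (tendsto_pow_atTop_nhds_zero_of_lt_one (r := (1 / 4 : ℝ))
    (by norm_num) (by norm_num))).const_mul K
  rw [add_zero, mul_zero] at h1
  exact h1.eventually (gt_mem_nhds hδ)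

/-- At the scales of even generations the solution descends faster than `-h ξ₀`. -/
theorem eventually_le_of_even (hh : Continuous h) {A K η : ℝ} (hK : 0 < K) (hη : 0 < η)
    (hηA : 4 * η ≤ A * K ^ 2)
    (hconvex : ∀ p : ℝ, |p| ≤ K → h ξ₀ + p * β + A * p ^ 2 ≤ h (ξ₀ + p • e))
    {ω : phaseGroup (barForms e f β γ)} (hω : ∀ᶠ k in atTop, (1 / 2 : ℝ) ^ k < ‖ω.1 k‖)
    {u : ℝ → Eucl d × ℝ → ℝ}
    (hu : ∀ ε : ℝ, 0 < ε → IsViscositySolution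
      (scaledHamiltonian h (fun x t => potential (barForms e f β γ) η x t ω) ε) ξ₀ (u ε))
    {t : ℝ} (ht : 0 < t) :
    ∀ᶠ k in atTop, Even k → u (zoom k)⁻¹ (0, t) ≤ -h ξ₀ * t - η / 8 * t := by
  obtain ⟨R, T, hslab⟩ := solution_le_of_slab hh ξ₀ e hK hη hηA ht hconvex
  filter_upwards [eventually_exists_bar _ (barForms_norm_le e f β γ) hω (max R T),
    eventually_error_lt K (show 0 < η / 8 * t by positivity)] with k hk hk' heven
  obtain ⟨y₀, hy₀, hbar⟩ := hk (-(β * t))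
  have h1 := hslab _ _ (fun x t => abs_potential_le _ hη.le _ _ ω)
    (hu (zoom k)⁻¹ (inv_pos.2 (zoom_pos k))) (zoom k)⁻¹ y₀ (inv_pos.2 (zoom_pos k))
    (fun x s hx hs0 hsT hxs => by
      have h2 := (hbar (x, s) ?_ ?_).1 heven
      · rw [potential_zoom]
        nlinarith
      · rw [Prod.norm_mk, Real.norm_of_nonneg hs0.le]
        exact max_le_max hx hsT.le
      · rw [barForms, if_pos heven, slabForm_apply]
        exact hxs)
  have h3 : |β * t + y₀| ≤ (1 / 4) ^ k := by
    rw [← abs_neg, neg_add]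
    exact hy₀
  have h4 : K * ((zoom k)⁻¹ + |β * t + y₀|) ≤ K * ((zoom k)⁻¹ + (1 / 4) ^ k) := by gcongr
  linarith

/-- At the scales of odd generations the solution descends more slowly than `-h ξ₀`. -/
theorem eventually_le_of_odd (hh : Continuous h) {A K η : ℝ} (hK : 0 < K) (hη : 0 < η)
    (hηA : 4 * η ≤ A * K ^ 2)
    (hconcave : ∀ p : ℝ, |p| ≤ K → h (ξ₀ + p • f) ≤ h ξ₀ + p * γ - A * p ^ 2)
    {ω : phaseGroup (barForms e f β γ)} (hω : ∀ᶠ k in atTop, (1 / 2 : ℝ) ^ k < ‖ω.1 k‖)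
    {u : ℝ → Eucl d × ℝ → ℝ}
    (hu : ∀ ε : ℝ, 0 < ε → IsViscositySolution
      (scaledHamiltonian h (fun x t => potential (barForms e f β γ) η x t ω) ε) ξ₀ (u ε))
    {t : ℝ} (ht : 0 < t) :
    ∀ᶠ k in atTop, ¬Even k → -h ξ₀ * t + η / 8 * t ≤ u (zoom k)⁻¹ (0, t) := by
  -- the previous estimate, for the dual problem
  obtain ⟨R, T, hslab⟩ := solution_le_of_slab (h := fun ξ => -h (-ξ)) (by fun_prop) (-ξ₀) f
    (β := γ) hK hη hηA ht (fun p hp => by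
      have h1 := hconcave (-p) (by rwa [abs_neg])
      rw [neg_add, neg_neg, ← neg_smul]
      linarith [show (-p) ^ 2 = p ^ 2 by ring])
  filter_upwards [eventually_exists_bar _ (barForms_norm_le e f β γ) hω (max R T),
    eventually_error_lt K (show 0 < η / 8 * t by positivity)] with k hk hk' hodd
  obtain ⟨y₀, hy₀, hbar⟩ := hk (-(γ * t))
  have h1 := hslab _ _ (fun x t => by
      rw [abs_neg]; exact abs_potential_le _ hη.le _ _ ω)
    (hu (zoom k)⁻¹ (inv_pos.2 (zoom_pos k))).neg (zoom k)⁻¹ y₀ (inv_pos.2 (zoom_pos k))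
    (fun x s hx hs0 hsT hxs => by
      have h2 := (hbar (x, s) ?_ ?_).2 hodd
      · simp only [potential_zoom]
        nlinarith
      · rw [Prod.norm_mk, Real.norm_of_nonneg hs0.le]
        exact max_le_max hx hsT.le
      · rw [barForms, if_neg hodd, slabForm_apply]
        exact hxs)
  have h3 : |γ * t + y₀| ≤ (1 / 4) ^ k := by
    rw [← abs_neg, neg_add]
    exact hy₀
  have h4 : K * ((zoom k)⁻¹ + |γ * t + y₀|) ≤ K * ((zoom k)⁻¹ + (1 / 4) ^ k) := by gcongr
  rw [neg_neg, neg_neg] at h1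
  linarith

end Main

theorem corollary1p2 {d : ℕ} (h : Eucl d → ℝ) (hsmooth : ContDiff ℝ 2 h)
    (hcoercive : Coercive h) (hsuperlinear : SuperlinearGrowth h) (ξ₀ : Eucl d)
    (m : ℕ) (hm : 1 ≤ m) (hmd : m < d)
    (hpos : Fintype.card {i // 0 < (hessianMatrix_isHermitian hsmooth ξ₀).eigenvalues i} = m)
    (hneg : Fintype.card {i // (hessianMatrix_isHermitian hsmooth ξ₀).eigenvalues i < 0} = d - m) :
    ∃ (Ω : Type) (_ : MeasurableSpace Ω) (P : Measure Ω) (_ : AddAction (Eucl d × ℝ) Ω)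
      (V : Eucl d → ℝ → Ω → ℝ),
      IsStationaryErgodicField P V ∧ IsBoundedLipschitzField V ∧
      -- for every realization and every `ε > 0` there is exactly one solution
      (∀ ω, ∀ ε : ℝ, 0 < ε → ∃ u : Eucl d × ℝ → ℝ,
        IsViscositySolution (scaledHamiltonian h (fun x t => V x t ω) ε) ξ₀ u ∧
        ∀ w : Eucl d × ℝ → ℝ,
          IsViscositySolution (scaledHamiltonian h (fun x t => V x t ω) ε) ξ₀ w →
          ∀ (x : Eucl d) (t : ℝ), 0 ≤ t → w (x, t) = u (x, t)) ∧
      -- and, almost surely, these solutions do not converge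
      ∀ᵐ ω ∂P, ∀ u : ℝ → Eucl d × ℝ → ℝ,
        (∀ ε : ℝ, 0 < ε →
          IsViscositySolution (scaledHamiltonian h (fun x t => V x t ω) ε) ξ₀ (u ε)) →
        ∀ t : ℝ, 0 < t →
          liminf (fun ε : ℝ => ((u ε (0, t) : ℝ) : EReal)) (𝓝[>] 0) <
            limsup (fun ε : ℝ => ((u ε (0, t) : ℝ) : EReal)) (𝓝[>] 0) := by
  have hh : Continuous h := hsmooth.continuous
  obtain ⟨i, hi⟩ : ∃ i, 0 < (hessianMatrix_isHermitian hsmooth ξ₀).eigenvalues i := by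
    obtain ⟨i⟩ := Fintype.card_pos_iff.1 (hpos ▸ hm : 0 < Fintype.card _)
    exact ⟨i.1, i.2⟩
  obtain ⟨j, hj⟩ : ∃ j, (hessianMatrix_isHermitian hsmooth ξ₀).eigenvalues j < 0 := by
    obtain ⟨j⟩ := Fintype.card_pos_iff.1 (hneg ▸ Nat.sub_pos_of_lt hmd : 0 < Fintype.card _)
    exact ⟨j.1, j.2⟩
  set e := (hessianMatrix_isHermitian hsmooth ξ₀).eigenvectorBasis i with he
  set f := (hessianMatrix_isHermitian hsmooth ξ₀).eigenvectorBasis j with hf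
  have he0 : e ≠ 0 := (OrthonormalBasis.orthonormal _).ne_zero i
  have hf0 : f ≠ 0 := (OrthonormalBasis.orthonormal _).ne_zero j
  rw [← fderiv_fderiv_eigenvector hsmooth ξ₀ i, ← he] at hi
  rw [← fderiv_fderiv_eigenvector hsmooth ξ₀ j, ← hf] at hj
  set β := fderiv ℝ h ξ₀ e with hβ
  set γ := fderiv ℝ h ξ₀ f with hγ
  obtain ⟨A₁, hA₁, K₁, hK₁, hconvex⟩ := exists_parabola_le hsmooth hi
  obtain ⟨A₂, hA₂, K₂, hK₂, hconcave⟩ := exists_parabola_le (h := fun ξ => -h ξ) hsmooth.neg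
    (ξ₀ := ξ₀) (e := f) (by
      have h1 : fderiv ℝ (fun ξ => -h ξ) = fun ξ => -fderiv ℝ h ξ := funext fun ξ => fderiv_fun_neg
      rw [h1, fderiv_fun_neg]
      simpa using hj)
  rw [fderiv_fun_neg] at hconcave
  set A := min A₁ A₂ with hA
  set K := min K₁ K₂ with hK
  have hA0 : 0 < A := lt_min hA₁ hA₂
  have hK0 : 0 < K := lt_min hK₁ hK₂
  set η := A * K ^ 2 / 4 with hη
  have hη0 : 0 < η := by positivity
  have hηA : 4 * η ≤ A * K ^ 2 := by rw [hη]; linarith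
  have hconvex' : ∀ p : ℝ, |p| ≤ K → h ξ₀ + p * β + A * p ^ 2 ≤ h (ξ₀ + p • e) := by
    intro p hp
    have h1 := hconvex p (hp.trans (min_le_left _ _))
    have h2 : A * p ^ 2 ≤ A₁ * p ^ 2 := by gcongr; exact min_le_left _ _
    linarith
  have hconcave' : ∀ p : ℝ, |p| ≤ K → h (ξ₀ + p • f) ≤ h ξ₀ + p * γ - A * p ^ 2 := by
    intro p hp
    have h1 := hconcave p (hp.trans (min_le_right _ _))
    have h2 : A * p ^ 2 ≤ A₂ * p ^ 2 := by gcongr; exact min_le_right _ _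
    simp only [_root_.neg_apply, ← hγ] at h1
    linarith
  refine ⟨phaseGroup (barForms e f β γ), inferInstance, phaseMeasure _, inferInstance,
    potential _ η, isStationaryErgodicField_potential _ η,
    isBoundedLipschitzField_potential _ hη0.le (barForms_norm_le e f β γ),
    fun ω ε hε => wellPosed hh ξ₀ _ hη0.le (barForms_norm_le e f β γ) ω hε, ?_⟩
  filter_upwards [ae_eventually_phase_large _ (barForms_ne_zero he0 hf0)] with ω hω u hu t ht
  have h1 : ∃ᶠ ε in 𝓝[>] (0 : ℝ), u ε (0, t) ≤ -h ξ₀ * t - η / 8 * t :=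
    frequently_small_scale Nat.frequently_even
      (eventually_le_of_even hh hK0 hη0 hηA hconvex' hω hu ht)
  have h2 : ∃ᶠ ε in 𝓝[>] (0 : ℝ), -h ξ₀ * t + η / 8 * t ≤ u ε (0, t) :=
    frequently_small_scale (Nat.frequently_odd.mono fun k hk => Nat.not_even_iff_odd.2 hk)
      (eventually_le_of_odd hh hK0 hη0 hηA hconcave' hω hu ht)
  have h3 : liminf (fun ε : ℝ => ((u ε (0, t) : ℝ) : EReal)) (𝓝[>] 0) ≤
      ((-h ξ₀ * t - η / 8 * t : ℝ) : EReal) :=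
    liminf_le_of_frequently_le' (h1.mono fun ε hε => EReal.coe_le_coe_iff.2 hε)
  have h4 : ((-h ξ₀ * t + η / 8 * t : ℝ) : EReal) ≤
      limsup (fun ε : ℝ => ((u ε (0, t) : ℝ) : EReal)) (𝓝[>] 0) :=
    le_limsup_of_frequently_le' (h2.mono fun ε hε => EReal.coe_le_coe_iff.2 hε)
  refine (h3.trans_lt (EReal.coe_lt_coe_iff.2 ?_)).trans_le h4
  have h5 : 0 < η / 8 * t := by positivity
  linarith
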